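/- Consider the system $x_{k+1}=Ax_k+Bu_k+(A_1x_k+B_1u_k)v_k+w_k$ with $x_k\in\mathbb R^n$, $u_k\in\mathbb R^m$, where $(w_k)$ is i.i.d. with mean zero and covariance $\Sigma\succ0$, $(v_k)$ is i.i.d. real-valued with mean zero and variance $\sigma>0$, the sequences $(w_k)$ and $(v_k)$ are independent, and $x_0$ is square integrable with positive definite covariance matrix and independent of $(w_k,v_k)_{k\ge0}$; put $X_0=\mathbb E[x_0x_0^\top]$. A gain $L\in\mathbb R^{m\times n}$ (the policy $u_k=Lx_k$) is called admissible if the closed-loop system $x_{k+1}=(A+BL)x_k+(A_1+B_1L)x_kv_k+w_k$ is mean square stable, i.e. for all initial states and noises as above $\mathbb E[x_k]$ and $\mathbb E[x_kx_k^\top]$ converge to limits that do not depend on the initial state. Let $Q\succeq0$, $R\succ0$, $W=Q\oplus R$, $\alpha\in(0,1)$. Assume that an admissible gain exists, that $(A,A_1|\sqrt Q)$ is exactly detectable (if $x_{k+1}=Ax_k+A_1x_kv_k$ with deterministic $x_0$ has $\sqrt Q x_k=0$ a.s. for all $k$, then $\mathbb E\|x_k\|^2\to0$), and that the stochastic LQR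 problem has a solution, i.e. some admissible $L^*$ minimizes $J(L,x_0)=\sum_{k\ge0}\alpha^k\,\mathbb E\big[x_k^\top(Q+L^\top RL)x_k\big]$ (along the closed loop) among all admissible $L$. Let $P^*\succeq0$ solve $$P=Q+\alpha A^\top PA+\alpha\sigma A_1^\top PA_1-\alpha^2(A^\top PB+\sigma A_1^\top PB_1)(R+\alpha B^\top PB+\alpha\sigma B_1^\top PB_1)^{-1}(B^\top PA+\sigma B_1^\top PA_1)$$ and let $H^*=\begin{bmatrix}H_{11}^*&H_{12}^*\\H_{12}^{*\top}&H_{22}^*\end{bmatrix}$ with $H_{11}^*=Q+\alpha A^\top P^*A+\alpha\sigma A_1^\top P^*A_1$, $H_{12}^*=\alpha A^\top P^*B+\alpha\sigma A_1^\top P^*B_1$, $H_{22}^*=R+\alpha B^\top P^*B+\alpha\sigma B_1^\top P^*B_1$. The dual problem is to maximize $\operatorname{Tr}\big((X_0+\frac{\alpha}{1-\alpha}\Sigma)M\big)$ over symmetric $F=\begin{bmatrix}F_{11}&F_{12}\\F_{12}^\top&F_{22}\end{bmatrix}\in\mathbb R^{(n+m)\times(n+m)}$ and $M\in\mathbb R^{n\times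 n}$ subject to $F_{22}\succ0$, $\mathscr P(F)-M\succeq0$ and $\alpha[A\ B]^\top\mathscr P(F)[A\ B]-F+W+\alpha\sigma[A_1\ B_1]^\top\mathscr P(F)[A_1\ B_1]\succeq0$, where $\mathscr P(F)=F_{11}-F_{12}F_{22}^{-1}F_{12}^\top$. Then $(F,M)=(H^*,P^*)$ is an optimal point of the dual problem. Moreover, for every optimal point $(F^*,M^*)$ of the dual problem (in particular for $F^*=H^*$) there is $\varepsilon_0>0$ such that for all $0<\varepsilon\le\varepsilon_0$ and every symmetric $\hat F$ with $\|\hat F-F^*\|_F\le\varepsilon$ the block $\hat F_{22}$ is invertible and the policy $u_k=\widehat{L^*}x_k$ with $\widehat{L^*}=-\hat F_{22}^{-1}\hat F_{12}^\top$ is admissible. Consequently, if $\hat F^{(N,K)}$ are symmetric with $\|\hat F^{(N,K)}-F^*\|_F\le\varepsilon(N,K)$ and $\varepsilon(N,K)\to0$ as $N,K\to\infty$, then for all sufficiently large $N$ and $K$ the block $\hat F^{(N,K)}_{22}$ is invertible and the policy with gain $-(\hat F^{(N,K)}_{22})^{-1}(\hat F^{(N,K)}_{12})^\top$ is admissible.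 -/

import Mathlib

open MeasureTheory ProbabilityTheory Filter Topology
open scoped Matrix

universe u

namespace StochLQR

section Noise

variable {Ω : Type u} [MeasurableSpace Ω]

/-- The matrix `E[x xᵀ]` of second moments of a random vector. -/
noncomputable def secondMoment {n : ℕ} (P : Measure Ω) (x : Ω → Fin n → ℝ) :
    Matrix (Fin n) (Fin n) ℝ :=
  Matrix.of fun i j => ∫ ω, x ω i * x ω j ∂P

/-- The mean vector `E[x]` of a random vector. -/
noncomputable def meanVec {n : ℕ} (P : Measure Ω) (x : Ω → Fin n → ℝ) : Fin n → ℝ :=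
  fun i => ∫ ω, x ω i ∂P

/-- The covariance matrix of a random vector. -/
noncomputable def covMatrix {n : ℕ} (P : Measure Ω) (x : Ω → Fin n → ℝ) :
    Matrix (Fin n) (Fin n) ℝ :=
  Matrix.of fun i j => cov[fun ω => x ω i, fun ω => x ω j; P]

/-- The multiplicative noise: i.i.d. real random variables with mean zero and variance `σ`,
where `0 < σ`. -/
structure IsMultiplicativeNoise (P : Measure Ω) (v : ℕ → Ω → ℝ) (σ : ℝ) : Prop where
  measurable : ∀ k, Measurable (v k)
  memLp : ∀ k, MemLp (v k) 2 P
  indep : iIndepFun v P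
  identDistrib : ∀ k, IdentDistrib (v k) (v 0) P P
  mean_zero : ∀ k, ∫ ω, v k ω ∂P = 0
  variance_eq : ∀ k, Var[v k; P] = σ
  variance_pos : 0 < σ

/-- The additive noise: i.i.d. random vectors with mean zero and positive definite
covariance matrix `Sig`. -/
structure IsAdditiveNoise {n : ℕ} (P : Measure Ω) (w : ℕ → Ω → Fin n → ℝ)
    (Sig : Matrix (Fin n) (Fin n) ℝ) : Prop where
  measurable : ∀ k, Measurable (w k)
  memLp : ∀ k, MemLp (w k) 2 P
  indep : iIndepFun w P
  identDistrib : ∀ k, IdentDistrib (w k) (w 0) P P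
  mean_zero : ∀ k, meanVec P (w k) = 0
  cov_eq : ∀ k, covMatrix P (w k) = Sig
  cov_posDef : Sig.PosDef

/-- The standing assumptions on the initial state `x0`, the additive noise `w` (covariance `Sig`)
and the multiplicative noise `v` (variance `σ`). -/
structure NoiseAssumption {n : ℕ} (P : Measure Ω) (x0 : Ω → Fin n → ℝ)
    (w : ℕ → Ω → Fin n → ℝ) (v : ℕ → Ω → ℝ)
    (Sig : Matrix (Fin n) (Fin n) ℝ) (σ : ℝ) : Prop where
  init_measurable : Measurable x0
  init_memLp : MemLp x0 2 P
  init_cov_posDef : (covMatrix P x0).PosDef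
  init_indep : IndepFun x0 (fun ω (k : ℕ) => (w k ω, v k ω)) P
  additive : IsAdditiveNoise P w Sig
  multiplicative : IsMultiplicativeNoise P v σ
  noise_indep : IndepFun (fun ω (k : ℕ) => w k ω) (fun ω (k : ℕ) => v k ω) P

/-- The solution of `x (k+1) = A x k + (A₁ x k) v k + w k`, `x 0 = x0`. -/
def traj {n : ℕ} (A A₁ : Matrix (Fin n) (Fin n) ℝ) (x0 : Ω → Fin n → ℝ)
    (w : ℕ → Ω → Fin n → ℝ) (v : ℕ → Ω → ℝ) : ℕ → Ω → Fin n → ℝ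
  | 0 => x0
  | k + 1 => fun ω =>
      A *ᵥ traj A A₁ x0 w v k ω + v k ω • (A₁ *ᵥ traj A A₁ x0 w v k ω) + w k ω

end Noise

/-- Mean square stability of `x (k+1) = A x k + (A₁ x k) v k + w k`: for all noise sequences there
are limits of the mean and of the second moment matrix that do not depend on the initial state. -/
def MeanSquareStable {n : ℕ} (A A₁ Sig : Matrix (Fin n) (Fin n) ℝ) (σ : ℝ) : Prop :=
  ∀ (Ω : Type u) [MeasurableSpace Ω] (P : Measure Ω) [IsProbabilityMeasure P]
    (w : ℕ → Ω → Fin n → ℝ) (v : ℕ → Ω → ℝ),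
    ∃ (m : Fin n → ℝ) (X : Matrix (Fin n) (Fin n) ℝ),
      ∀ x0 : Ω → Fin n → ℝ, NoiseAssumption P x0 w v Sig σ →
        Tendsto (fun k => meanVec P (traj A A₁ x0 w v k)) atTop (𝓝 m) ∧
        Tendsto (fun k => secondMoment P (traj A A₁ x0 w v k)) atTop (𝓝 X)

/-- Exact detectability of `(A, A₁ | C)`: if the output `C x k` of
`x (k+1) = A x k + (A₁ x k) v k` vanishes almost surely at all times, then `E‖x k‖² → 0`. -/
def ExactlyDetectable {n : ℕ} (A A₁ C : Matrix (Fin n) (Fin n) ℝ) (σ : ℝ) : Prop :=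
  ∀ (Ω : Type u) [MeasurableSpace Ω] (P : Measure Ω) [IsProbabilityMeasure P]
    (v : ℕ → Ω → ℝ), IsMultiplicativeNoise P v σ → ∀ ξ : Fin n → ℝ,
      (∀ k, ∀ᵐ ω ∂P, C *ᵥ traj A A₁ (fun _ => ξ) 0 v k ω = 0) →
      Tendsto (fun k => ∫ ω, traj A A₁ (fun _ => ξ) 0 v k ω ⬝ᵥ traj A A₁ (fun _ => ξ) 0 v k ω ∂P)
        atTop (𝓝 0)

open scoped MatrixOrder in
/-- The positive semidefinite square root of a positive semidefinite matrix. -/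
noncomputable def psdSqrt {n : ℕ} (Q : Matrix (Fin n) (Fin n) ℝ) : Matrix (Fin n) (Fin n) ℝ :=
  CFC.sqrt Q

open scoped Matrix.Norms.Frobenius in
/-- The Frobenius norm. -/
noncomputable def frobNorm {ι : Type*} [Fintype ι] (M : Matrix ι ι ℝ) : ℝ := ‖M‖

/-- The coefficients of `x (k+1) = A x k + B u k + (A₁ x k + B₁ u k) v k + w k`, the noise
statistics, the weights and the discount factor of the stochastic LQR problem. -/
structure Data (n m : ℕ) where
  A : Matrix (Fin n) (Fin n) ℝ
  B : Matrix (Fin n) (Fin m) ℝ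
  A₁ : Matrix (Fin n) (Fin n) ℝ
  B₁ : Matrix (Fin n) (Fin m) ℝ
  /-- covariance matrix of the additive noise -/
  Sig : Matrix (Fin n) (Fin n) ℝ
  /-- variance of the multiplicative noise -/
  σ : ℝ
  /-- state weight -/
  Q : Matrix (Fin n) (Fin n) ℝ
  /-- input weight -/
  R : Matrix (Fin m) (Fin m) ℝ
  /-- discount factor -/
  α : ℝ
  Q_posSemidef : Q.PosSemidef
  R_posDef : R.PosDef
  α_pos : 0 < α
  α_lt_one : α < 1

namespace Data

variable {n m : ℕ} (S : Data n m)

/-- The feedback `u k = L x k` is admissible: the closed-loop system is mean square stable. -/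
def Admissible (L : Matrix (Fin m) (Fin n) ℝ) : Prop :=
  MeanSquareStable.{u} (S.A + S.B * L) (S.A₁ + S.B₁ * L) S.Sig S.σ

/-- `W = Q ⊕ R`. -/
def W : Matrix (Fin n ⊕ Fin m) (Fin n ⊕ Fin m) ℝ := Matrix.fromBlocks S.Q 0 0 S.R

/-- The discounted cost `J(L, x0) = ∑ₖ αᵏ E [xₖ; L xₖ]ᵀ W [xₖ; L xₖ]`; it is only compared on
admissible gains, where all second moments are finite and bounded in `k`. -/
noncomputable def cost {Ω : Type u} [MeasurableSpace Ω] (P : Measure Ω) (x0 : Ω → Fin n → ℝ)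
    (w : ℕ → Ω → Fin n → ℝ) (v : ℕ → Ω → ℝ) (L : Matrix (Fin m) (Fin n) ℝ) : ℝ :=
  ∑' k : ℕ, S.α ^ k * ∫ ω,
    (let x := traj (S.A + S.B * L) (S.A₁ + S.B₁ * L) x0 w v k ω
     Sum.elim x (L *ᵥ x) ⬝ᵥ S.W *ᵥ Sum.elim x (L *ᵥ x)) ∂P

/-- `L` solves the stochastic LQR problem: it is admissible and minimizes the cost among all
admissible gains. -/
def IsOptimalGain {Ω : Type u} [MeasurableSpace Ω] (P : Measure Ω) (x0 : Ω → Fin n → ℝ)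
    (w : ℕ → Ω → Fin n → ℝ) (v : ℕ → Ω → ℝ) (L : Matrix (Fin m) (Fin n) ℝ) : Prop :=
  Admissible.{u} S L ∧
    ∀ L' : Matrix (Fin m) (Fin n) ℝ, Admissible.{u} S L' →
      S.cost P x0 w v L ≤ S.cost P x0 w v L'

/-- The block `H₂₂ = R + α Bᵀ P B + α σ B₁ᵀ P B₁`. -/
def H₂₂ (P : Matrix (Fin n) (Fin n) ℝ) : Matrix (Fin m) (Fin m) ℝ :=
  S.R + S.α • (S.Bᵀ * P * S.B) + (S.α * S.σ) • (S.B₁ᵀ * P * S.B₁)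

/-- The block `H₁₂ = α Aᵀ P B + α σ A₁ᵀ P B₁`. -/
def H₁₂ (P : Matrix (Fin n) (Fin n) ℝ) : Matrix (Fin n) (Fin m) ℝ :=
  S.α • (S.Aᵀ * P * S.B) + (S.α * S.σ) • (S.A₁ᵀ * P * S.B₁)

/-- The block `H₁₁ = Q + α Aᵀ P A + α σ A₁ᵀ P A₁`. -/
def H₁₁ (P : Matrix (Fin n) (Fin n) ℝ) : Matrix (Fin n) (Fin n) ℝ :=
  S.Q + S.α • (S.Aᵀ * P * S.A) + (S.α * S.σ) • (S.A₁ᵀ * P * S.A₁)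

/-- The parameter matrix `H` of the Q-function that belongs to `P`. -/
def H (P : Matrix (Fin n) (Fin n) ℝ) : Matrix (Fin n ⊕ Fin m) (Fin n ⊕ Fin m) ℝ :=
  Matrix.fromBlocks (S.H₁₁ P) (S.H₁₂ P) (S.H₁₂ P)ᵀ (S.H₂₂ P)

/-- `P` is a positive semidefinite solution of the discrete-time generalized algebraic Riccati
equation. -/
def IsRiccatiSolution (P : Matrix (Fin n) (Fin n) ℝ) : Prop :=
  P.PosSemidef ∧
    P = S.Q + S.α • (S.Aᵀ * P * S.A) + (S.α * S.σ) • (S.A₁ᵀ * P * S.A₁)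
      - S.α ^ 2 • ((S.Aᵀ * P * S.B + S.σ • (S.A₁ᵀ * P * S.B₁)) *
          (S.R + S.α • (S.Bᵀ * P * S.B) + (S.α * S.σ) • (S.B₁ᵀ * P * S.B₁))⁻¹ *
          (S.Bᵀ * P * S.A + S.σ • (S.B₁ᵀ * P * S.A₁)))

end Data

/-- The Schur complement `F₁₁ - F₁₂ F₂₂⁻¹ F₁₂ᵀ`. -/
noncomputable def schur {n m : ℕ} (F : Matrix (Fin n ⊕ Fin m) (Fin n ⊕ Fin m) ℝ) :
    Matrix (Fin n) (Fin n) ℝ :=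
  F.toBlocks₁₁ - F.toBlocks₁₂ * F.toBlocks₂₂⁻¹ * F.toBlocks₁₂ᵀ

/-- The feedback gain `-F₂₂⁻¹ F₁₂ᵀ`. -/
noncomputable def gain {n m : ℕ} (F : Matrix (Fin n ⊕ Fin m) (Fin n ⊕ Fin m) ℝ) :
    Matrix (Fin m) (Fin n) ℝ :=
  -(F.toBlocks₂₂⁻¹ * F.toBlocks₁₂ᵀ)

namespace Data

variable {n m : ℕ} (S : Data n m)

/-- Feasible points `(F, M)` of the dual problem. -/
structure DualFeasible (F : Matrix (Fin n ⊕ Fin m) (Fin n ⊕ Fin m) ℝ)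
    (M : Matrix (Fin n) (Fin n) ℝ) : Prop where
  symm : F.IsSymm
  posDef : F.toBlocks₂₂.PosDef
  schur_ge : (schur F - M).PosSemidef
  lmi : (S.α • ((Matrix.fromCols S.A S.B)ᵀ * schur F * Matrix.fromCols S.A S.B) - F + S.W
      + (S.α * S.σ) • ((Matrix.fromCols S.A₁ S.B₁)ᵀ * schur F *
          Matrix.fromCols S.A₁ S.B₁)).PosSemidef

/-- Optimal points of the dual problem: maximize `Tr ((X₀ + α / (1 - α) Σ) M)` over all feasible
`(F, M)`, where `X₀ = E[x₀ x₀ᵀ]`. -/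
def DualOptimal (X₀ : Matrix (Fin n) (Fin n) ℝ)
    (F : Matrix (Fin n ⊕ Fin m) (Fin n ⊕ Fin m) ℝ) (M : Matrix (Fin n) (Fin n) ℝ) : Prop :=
  S.DualFeasible F M ∧
    ∀ F' M', S.DualFeasible F' M' →
      ((X₀ + (S.α / (1 - S.α)) • S.Sig) * M').trace ≤
        ((X₀ + (S.α / (1 - S.α)) • S.Sig) * M).trace

end Data

end StochLQR

namespace StochLQR

open scoped MatrixOrder
open Matrix

/-! ### The positive semidefinite cone -/

section PosSemidef

variable {ι κ : Type*} [Fintype ι] [Fintype κ]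

/-! Along the closed loop with gain `L` the second moments obey `X ↦ T X + Σ`, where `T = closedLoop
L` preserves positive semidefiniteness. Admissibility of `L` amounts to `T ^ k → 0`
(`admissible_iff_powStable`): the trajectories from `x0` and `2 x0` under the same noise have second
moments differing by `3 T ^ k X₀`, and `X₀` is positive definite. A Lyapunov inequality
characterizes this stability, so it is an open condition on `L` (`eventually_powStable`).

Let `P` solve the Riccati equation and let `K` be its gain. Completing the square shows that `P` is
the discounted cost matrix of `K`. If `α T` were unstable for `K`, a Krein–Rutman eigenvector with
eigenvalue at least one would carry no running cost, hence no input, and would contradict exact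
detectability (`powStable_of_exactlyDetectable`). Stability of `α T` yields `M ≤ schur F ≤ P` for
every dual feasible `(F, M)`. This comparison gives optimality of `(H P, P)` and uniqueness of `P`.
As the weight in the dual objective is positive definite, every optimal point has `M = schur F = P`,
and completing the square in `F` then forces `gain F = K` (`DualOptimal.gain_eq`).

Detectability stabilizes only the discounted loop; admissibility of `K` comes from the optimal gain
`L`. A small step from `L` towards the minimizer of its Q-function stays admissible and would lower
the cost unless `L` is that minimizer, so the cost matrix of `L` solves the Riccati equation
(`IsOptimalGain.exists_isRiccatiSolution`). By uniqueness `L = K = gain F`, and continuity of `gain`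
with openness of stability finishes the proof. -/

theorem posSemidef_iff_isSymm_dotProduct {M : Matrix ι ι ℝ} :
    M.PosSemidef ↔ M.IsSymm ∧ ∀ x, 0 ≤ x ⬝ᵥ M *ᵥ x := by
  rw [posSemidef_iff_dotProduct_mulVec]
  simp [IsHermitian, conjTranspose_eq_transpose_of_trivial, IsSymm]

theorem _root_.Matrix.PosSemidef.isSymm {M : Matrix ι ι ℝ} (h : M.PosSemidef) : M.IsSymm :=
  (posSemidef_iff_isSymm_dotProduct.1 h).1

theorem _root_.Matrix.PosSemidef.conj_transpose {M : Matrix ι ι ℝ} (h : M.PosSemidef)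
    (C : Matrix κ ι ℝ) : (C * M * Cᵀ).PosSemidef := by
  simpa [conjTranspose_eq_transpose_of_trivial] using h.mul_mul_conjTranspose_same C

theorem _root_.Matrix.PosSemidef.transpose_conj {M : Matrix ι ι ℝ} (h : M.PosSemidef)
    (C : Matrix ι κ ℝ) : (Cᵀ * M * C).PosSemidef := by
  simpa [conjTranspose_eq_transpose_of_trivial] using h.conjTranspose_mul_mul_same C

theorem posSemidef_vecMulVec_self (x : ι → ℝ) : (vecMulVec x x).PosSemidef := by
  simpa using posSemidef_vecMulVec_self_star x

theorem trace_mul_vecMulVec_self (M : Matrix ι ι ℝ) (x : ι → ℝ) :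
    (M * vecMulVec x x).trace = x ⬝ᵥ M *ᵥ x := by
  rw [mul_vecMulVec, trace_vecMulVec, dotProduct_comm]

theorem isClosed_setOf_posSemidef : IsClosed {M : Matrix ι ι ℝ | M.PosSemidef} := by
  simp only [posSemidef_iff_isSymm_dotProduct, Set.ofPred_and, IsSymm, Set.ofPred_forall]
  refine (isClosed_eq (by fun_prop) (by fun_prop)).inter (isClosed_iInter fun x => ?_)
  exact isClosed_le continuous_const (by fun_prop)

theorem le_of_tendsto_matrix {α : Type*} {l : Filter α} [l.NeBot] {f g : α → Matrix ι ι ℝ}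
    {a b : Matrix ι ι ℝ} (hf : Tendsto f l (𝓝 a)) (hg : Tendsto g l (𝓝 b))
    (h : ∀ᶠ x in l, f x ≤ g x) : a ≤ b :=
  isClosed_setOf_posSemidef.mem_of_tendsto (hg.sub hf) h

/-- Testing on `eᵢ ± eⱼ` bounds `2 |M i j|` by `M i i + M j j`. On the cone, convergence to zero
thus reduces to convergence of traces. -/
theorem abs_apply_le_trace {M : Matrix ι ι ℝ} (h : M.PosSemidef) (i j : ι) :
    |M i j| ≤ M.trace := by
  classical
  have hd : ∀ i, 0 ≤ M i i := fun i => h.diag_nonneg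
  have hq := (posSemidef_iff_isSymm_dotProduct.1 h).2
  have hs : M j i = M i j := h.isSymm.apply i j
  have hle : ∀ i, M i i ≤ M.trace := fun i =>
    Finset.single_le_sum (f := fun i => M i i) (fun i _ => hd i) (Finset.mem_univ i)
  have h1 := hq (Pi.single i 1 + Pi.single j 1)
  have h2 := hq (Pi.single i 1 - Pi.single j 1)
  simp only [mulVec_add, mulVec_sub, add_dotProduct, sub_dotProduct, dotProduct_add,
    dotProduct_sub, mulVec_single_one, single_dotProduct, col_apply, one_mul, hs] at h1 h2
  rw [abs_le]
  constructor <;> linarith [hle i, hle j]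

theorem trace_le_trace_of_le {M N : Matrix ι ι ℝ} (h : M ≤ N) : M.trace ≤ N.trace := by
  have := PosSemidef.trace_nonneg (A := N - M) h
  rw [trace_sub] at this
  linarith

theorem tendsto_zero_of_trace {α : Type*} {l : Filter α} {f : α → Matrix ι ι ℝ}
    (hf : ∀ x, (f x).PosSemidef) (h : Tendsto (fun x => (f x).trace) l (𝓝 0)) :
    Tendsto f l (𝓝 0) :=
  tendsto_pi_nhds.2 fun i => tendsto_pi_nhds.2 fun j =>
    squeeze_zero_norm (fun x => abs_apply_le_trace (hf x) i j) h

theorem tendsto_trace {α : Type*} {l : Filter α} {f : α → Matrix ι ι ℝ} {a : Matrix ι ι ℝ}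
    (h : Tendsto f l (𝓝 a)) : Tendsto (fun x => (f x).trace) l (𝓝 a.trace) := by
  have hc : Continuous fun M : Matrix ι ι ℝ => M.trace := by fun_prop
  exact (hc.tendsto a).comp h

theorem tendsto_zero_of_le {α : Type*} {l : Filter α} {f g : α → Matrix ι ι ℝ}
    (hf : ∀ x, (f x).PosSemidef) (h : ∀ x, f x ≤ g x) (hg : Tendsto g l (𝓝 0)) :
    Tendsto f l (𝓝 0) :=
  tendsto_zero_of_trace hf <| squeeze_zero (fun x => (hf x).trace_nonneg)
    (fun x => trace_le_trace_of_le (h x)) (by simpa using tendsto_trace hg)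

theorem posSemidef_of_trace_mul_nonneg {M : Matrix ι ι ℝ} (hM : M.IsSymm)
    (h : ∀ Y : Matrix ι ι ℝ, Y.PosSemidef → 0 ≤ (M * Y).trace) : M.PosSemidef := by
  refine posSemidef_iff_isSymm_dotProduct.2 ⟨hM, fun x => ?_⟩
  rw [← trace_mul_vecMulVec_self]
  exact h _ (posSemidef_vecMulVec_self x)

variable [DecidableEq ι]

theorem exists_eq_transpose_mul_self {M : Matrix ι ι ℝ} (h : M.PosSemidef) :
    ∃ C : Matrix ι ι ℝ, M = Cᵀ * C := by
  refine ⟨CFC.sqrt M, ?_⟩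
  have h1 : (CFC.sqrt M).PosSemidef := nonneg_iff_posSemidef.1 (CFC.sqrt_nonneg M)
  rw [h1.isSymm, CFC.sqrt_mul_sqrt_self M (nonneg_iff_posSemidef.2 h)]

theorem trace_mul_nonneg {M N : Matrix ι ι ℝ} (hM : M.PosSemidef) (hN : N.PosSemidef) :
    0 ≤ (M * N).trace := by
  obtain ⟨C, rfl⟩ := exists_eq_transpose_mul_self hN
  rw [← Matrix.mul_assoc, trace_mul_comm, ← Matrix.mul_assoc]
  exact (hM.conj_transpose C).trace_nonneg

theorem exists_smul_one_le {X : Matrix ι ι ℝ} (hX : X.PosDef) :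
    ∃ c : ℝ, 0 < c ∧ c • (1 : Matrix ι ι ℝ) ≤ X := by
  have hs := hX.isHermitian.spectrum_real_eq_range_eigenvalues
  obtain ⟨c, hc, h⟩ : ∃ c : ℝ, 0 < c ∧ ∀ i, c ≤ hX.isHermitian.eigenvalues i := by
    rcases isEmpty_or_nonempty ι with h | h
    · exact ⟨1, one_pos, fun i => h.elim i⟩
    · obtain ⟨i, hi⟩ := Finite.exists_min hX.isHermitian.eigenvalues
      exact ⟨_, hX.eigenvalues_pos i, hi⟩
  refine ⟨c, hc, ?_⟩
  have : algebraMap ℝ (Matrix ι ι ℝ) c ≤ X := by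
    refine (algebraMap_le_iff_le_spectrum hX.isHermitian.isSelfAdjoint).2 fun x hx => ?_
    rw [hs] at hx
    obtain ⟨i, rfl⟩ := hx
    exact h i
  rwa [Algebra.algebraMap_eq_smul_one] at this

theorem exists_le_smul_one {X : Matrix ι ι ℝ} (hX : X.PosSemidef) :
    ∃ c : ℝ, 0 < c ∧ X ≤ c • (1 : Matrix ι ι ℝ) := by
  have hs := hX.isHermitian.spectrum_real_eq_range_eigenvalues
  obtain ⟨c, hc, h⟩ : ∃ c : ℝ, 0 < c ∧ ∀ i, hX.isHermitian.eigenvalues i ≤ c := by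
    obtain ⟨M, hM⟩ := (Set.finite_range hX.isHermitian.eigenvalues).bddAbove
    exact ⟨max M 1, by positivity, fun i => (hM ⟨i, rfl⟩).trans (le_max_left _ _)⟩
  refine ⟨c, hc, ?_⟩
  have : X ≤ algebraMap ℝ (Matrix ι ι ℝ) c := by
    refine (le_algebraMap_iff_spectrum_le hX.isHermitian.isSelfAdjoint).2 fun x hx => ?_
    rw [hs] at hx
    obtain ⟨i, rfl⟩ := hx
    exact h i
  rwa [Algebra.algebraMap_eq_smul_one] at this

theorem posDef_of_smul_one_le {ι : Type*} [DecidableEq ι] {X : Matrix ι ι ℝ} {c : ℝ} (hc : 0 < c)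
    (h : c • (1 : Matrix ι ι ℝ) ≤ X) : X.PosDef := by
  have := (PosDef.one (n := ι) (R := ℝ)).smul hc
  simpa using this.add_posSemidef h

/-- A positive semidefinite matrix with trace zero against a positive definite one vanishes. -/
theorem eq_zero_of_trace_mul_le_zero {X D : Matrix ι ι ℝ} (hX : X.PosDef) (hD : D.PosSemidef)
    (h : (X * D).trace ≤ 0) : D = 0 := by
  obtain ⟨c, hc, hcX⟩ := exists_smul_one_le hX
  have h1 := trace_mul_nonneg (M := X - c • 1) hcX hD
  rw [sub_mul, trace_sub, smul_mul_assoc, one_mul, trace_smul, smul_eq_mul] at h1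
  have h2 := hD.trace_nonneg
  have h3 : D.trace = 0 := by nlinarith
  exact hD.trace_eq_zero_iff.1 h3

theorem eventually_posDef {α : Type*} {l : Filter α} {f : α → Matrix ι ι ℝ} {a : Matrix ι ι ℝ}
    (hf : Tendsto f l (𝓝 a)) (ha : a.PosDef) (hs : ∀ x, (f x).IsSymm) :
    ∀ᶠ x in l, (f x).PosDef := by
  obtain ⟨c, hc, hca⟩ := exists_smul_one_le ha
  -- Entrywise errors below `d` change the quadratic form by at most `d * card ι * |y|²`; the extra
  -- one also covers an empty index type.
  have hN : (0 : ℝ) < Fintype.card ι + 1 := by positivity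
  have hev : ∀ᶠ x in l, ∀ i j, |f x i j - a i j| < c / 2 / (Fintype.card ι + 1) := by
    refine eventually_all.2 fun i => eventually_all.2 fun j => ?_
    have := ((tendsto_pi_nhds.1 (tendsto_pi_nhds.1 hf i) j).sub_const (a i j)).abs
    rw [sub_self, abs_zero] at this
    exact this.eventually (gt_mem_nhds (by positivity))
  filter_upwards [hev] with x hx
  refine posDef_of_smul_one_le (c := c / 2) (by positivity) ?_
  refine posSemidef_iff_isSymm_dotProduct.2 ⟨(hs x).sub (by simp [IsSymm]), fun y => ?_⟩
  have h1 := (posSemidef_iff_isSymm_dotProduct.1 (le_iff.1 hca)).2 y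
  have hyy : y ⬝ᵥ (1 : Matrix ι ι ℝ) *ᵥ y = ∑ i, y i ^ 2 := by
    simp [dotProduct, sq]
  have h2 : |y ⬝ᵥ (f x - a) *ᵥ y| ≤ c / 2 * ∑ i, y i ^ 2 := by
    have e : y ⬝ᵥ (f x - a) *ᵥ y = ∑ i, ∑ j, y i * ((f x i j - a i j) * y j) := by
      simp [dotProduct, mulVec, Finset.mul_sum]
    rw [e]
    set d := c / 2 / (Fintype.card ι + 1) with hd
    have hd0 : 0 < d := by positivity
    calc _ ≤ ∑ i, ∑ j, |y i * ((f x i j - a i j) * y j)| :=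
          (Finset.abs_sum_le_sum_abs _ _).trans
            (Finset.sum_le_sum fun i _ => Finset.abs_sum_le_sum_abs _ _)
      _ ≤ ∑ i, ∑ j, d * (y i ^ 2 / 2 + y j ^ 2 / 2) := by
          refine Finset.sum_le_sum fun i _ => Finset.sum_le_sum fun j _ => ?_
          rw [abs_mul, abs_mul]
          have h3 := (hx i j).le
          have h4 : |y i| * |y j| ≤ y i ^ 2 / 2 + y j ^ 2 / 2 := by
            nlinarith [sq_nonneg (|y i| - |y j|), sq_abs (y i), sq_abs (y j)]
          calc _ = |f x i j - a i j| * (|y i| * |y j|) := by ring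
            _ ≤ _ := by gcongr
      _ = d * (Fintype.card ι * ∑ i, y i ^ 2) := by
          simp only [← Finset.mul_sum, Finset.sum_add_distrib, Finset.sum_const,
            Finset.card_univ, nsmul_eq_mul, ← Finset.sum_div]
          ring
      _ ≤ _ := by
          have h5 : c / 2 = d * (Fintype.card ι + 1) := by rw [hd]; field_simp
          have h6 : (0 : ℝ) ≤ ∑ i, y i ^ 2 := Finset.sum_nonneg fun i _ => sq_nonneg _
          rw [h5]
          nlinarith [mul_nonneg hd0.le h6]
  rw [sub_mulVec, dotProduct_sub, smul_mulVec, dotProduct_smul, hyy, smul_eq_mul] at h1 ⊢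
  rw [sub_mulVec, dotProduct_sub] at h2
  linarith [(abs_le.1 h2).1]

end PosSemidef

end StochLQR

namespace StochLQR

open scoped MatrixOrder
open Matrix

/-! ### Positive maps, Lyapunov inequalities and a Krein–Rutman alternative -/

section PositiveOperators

variable {ι : Type*}

/-- A linear map on matrices that preserves positive semidefiniteness. -/
def PosMap (T : Matrix ι ι ℝ →ₗ[ℝ] Matrix ι ι ℝ) : Prop :=
  ∀ X, X.PosSemidef → (T X).PosSemidef

variable {T : Matrix ι ι ℝ →ₗ[ℝ] Matrix ι ι ℝ}

theorem PosMap.mono (hT : PosMap T) {X Y : Matrix ι ι ℝ} (h : X ≤ Y) : T X ≤ T Y := by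
  have := hT _ h
  rwa [map_sub] at this

theorem PosMap.pow (hT : PosMap T) (k : ℕ) : PosMap (T ^ k) := by
  induction k with
  | zero => exact fun X hX => by simpa using hX
  | succ k ih => exact fun X hX => by rw [pow_succ']; exact hT _ (ih X hX)

theorem PosMap.smul (hT : PosMap T) {t : ℝ} (ht : 0 ≤ t) : PosMap (t • T) :=
  fun X hX => (hT X hX).smul ht

variable [Fintype ι]

theorem PosMap.pow_le_of_le (hT : PosMap T) {R : Matrix ι ι ℝ} {q : ℝ} (hq : 0 ≤ q)
    (h : T R ≤ q • R) (k : ℕ) : (T ^ k) R ≤ q ^ k • R := by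
  induction k with
  | zero => simp
  | succ k ih =>
    rw [pow_succ', pow_succ, mul_smul]
    calc T ((T ^ k) R) ≤ T (q ^ k • R) := hT.mono ih
      _ = q ^ k • T R := by rw [map_smul]
      _ ≤ q ^ k • (q • R) := smul_le_smul_of_nonneg_left h (pow_nonneg hq k)

theorem continuous_matrixMap (T : Matrix ι ι ℝ →ₗ[ℝ] Matrix ι ι ℝ) : Continuous T :=
  T.continuous_of_finiteDimensional

variable [DecidableEq ι]

/-- The powers of `T` tend to zero on the identity matrix; for a positive map this is
equivalent to convergence of the powers to zero on all positive semidefinite matrices. -/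
def PowStable (T : Matrix ι ι ℝ →ₗ[ℝ] Matrix ι ι ℝ) : Prop :=
  Tendsto (fun k => (T ^ k) 1) atTop (𝓝 0)

theorem PowStable.tendsto (hT : PosMap T) (h : PowStable T) {X : Matrix ι ι ℝ}
    (hX : X.PosSemidef) : Tendsto (fun k => (T ^ k) X) atTop (𝓝 0) := by
  obtain ⟨c, -, hc⟩ := exists_le_smul_one hX
  refine tendsto_zero_of_le (g := fun k => c • (T ^ k) 1) (fun k => hT.pow k X hX) (fun k => ?_)
    (by simpa using h.const_smul c)
  rw [← map_smul]
  exact (hT.pow k).mono hc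

theorem PowStable.of_posDef (hT : PosMap T) {X : Matrix ι ι ℝ} (hX : X.PosDef)
    (h : Tendsto (fun k => (T ^ k) X) atTop (𝓝 0)) : PowStable T := by
  obtain ⟨c, hc, hcX⟩ := exists_smul_one_le hX
  refine tendsto_zero_of_le (g := fun k => c⁻¹ • (T ^ k) X)
    (fun k => hT.pow k 1 .one) (fun k => ?_) (by simpa using h.const_smul c⁻¹)
  rw [← map_smul]
  refine (hT.pow k).mono ?_
  have := smul_le_smul_of_nonneg_left hcX (inv_nonneg.2 hc.le)
  rwa [smul_smul, inv_mul_cancel₀ hc.ne', one_smul] at this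

/-- A Lyapunov inequality yields a geometric contraction. -/
theorem PosMap.exists_contraction (hT : PosMap T) {R : Matrix ι ι ℝ} (hR : R.PosSemidef) {c : ℝ}
    (hc : 0 < c) (h : c • (1 : Matrix ι ι ℝ) ≤ R - T R) :
    c • (1 : Matrix ι ι ℝ) ≤ R ∧ ∃ q : ℝ, 0 ≤ q ∧ q < 1 ∧ T R ≤ q • R := by
  refine ⟨h.trans (by simpa using nonneg_iff_posSemidef.2 (hT R hR)), ?_⟩
  obtain ⟨d, hd, hRd⟩ := exists_le_smul_one hR
  have hmax : 0 < max d c := lt_max_of_lt_left hd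
  -- From `R ≤ max d c • 1` one gets `(c / max d c) • R ≤ c • 1 ≤ R - T R`; the maximum with `c`
  -- keeps the rate nonnegative.
  refine ⟨1 - c / max d c, ?_, ?_, ?_⟩
  · have : c / max d c ≤ 1 := (div_le_one hmax).2 (le_max_right _ _)
    linarith
  · have : 0 < c / max d c := by positivity
    linarith
  · have h1 : (c / max d c) • R ≤ c • (1 : Matrix ι ι ℝ) := by
      have h2 : R ≤ max d c • (1 : Matrix ι ι ℝ) :=
        hRd.trans (smul_le_smul_of_nonneg_right (le_max_left _ _)
          (nonneg_iff_posSemidef.2 .one))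
      have := smul_le_smul_of_nonneg_left h2 (show 0 ≤ c / max d c by positivity)
      rwa [smul_smul, div_mul_cancel₀ _ hmax.ne'] at this
    rw [sub_smul, one_smul]
    have := h1.trans h
    rwa [le_sub_comm] at this

theorem PowStable.of_lyapunov (hT : PosMap T) {R : Matrix ι ι ℝ} (hR : R.PosSemidef) {c : ℝ}
    (hc : 0 < c) (h : c • (1 : Matrix ι ι ℝ) ≤ R - T R) : PowStable T := by
  obtain ⟨hcR, q, hq0, hq1, hq⟩ := hT.exists_contraction hR hc h
  refine PowStable.of_posDef hT (posDef_of_smul_one_le hc hcR) ?_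
  refine tendsto_zero_of_le (fun k => hT.pow k R hR) (hT.pow_le_of_le hq0 hq) ?_
  simpa using (tendsto_pow_atTop_nhds_zero_of_lt_one hq0 hq1).smul_const R

/-- Once `T ^ N 1` is below `1 / 2`, the finite sum `R = ∑ k < N, T ^ k 1` works, because `R - T R`
telescopes to `1 - T ^ N 1`. Two-sided bounds independent of `T` are what the compactness argument
in `PosMap.exists_eigenvector` needs. -/
theorem PowStable.exists_lyapunov (hT : PosMap T) (h : PowStable T) :
    ∃ R : Matrix ι ι ℝ, R.PosSemidef ∧ (1 / 2 : ℝ) • (1 : Matrix ι ι ℝ) ≤ R - T R ∧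
      R - T R ≤ 1 := by
  have hev : ∀ᶠ k in atTop, ((1 / 2 : ℝ) • (1 : Matrix ι ι ℝ) - (T ^ k) 1).PosDef := by
    refine eventually_posDef (a := (1 / 2 : ℝ) • (1 : Matrix ι ι ℝ))
      (by simpa using tendsto_const_nhds.sub h) (PosDef.one.smul (by norm_num)) fun k => ?_
    exact IsSymm.sub (by simp [IsSymm]) (hT.pow k 1 .one).isSymm
  obtain ⟨N, hN⟩ := hev.exists
  have key : (∑ k ∈ Finset.range N, (T ^ k) 1) - T (∑ k ∈ Finset.range N, (T ^ k) 1)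
      = 1 - (T ^ N) 1 := by
    have h1 : T (∑ k ∈ Finset.range N, (T ^ k) 1) = ∑ k ∈ Finset.range N, (T ^ (k + 1)) 1 := by
      rw [map_sum]
      exact Finset.sum_congr rfl fun k _ => by rw [pow_succ']; rfl
    rw [h1, ← Finset.sum_sub_distrib, Finset.sum_range_sub']
    simp
  refine ⟨∑ k ∈ Finset.range N, (T ^ k) 1, posSemidef_sum _ fun k _ => hT.pow k 1 .one, ?_, ?_⟩
  · have h2 : (1 : Matrix ι ι ℝ) - (T ^ N) 1 - (1 / 2 : ℝ) • (1 : Matrix ι ι ℝ)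
        = (1 / 2 : ℝ) • (1 : Matrix ι ι ℝ) - (T ^ N) 1 := by
      module
    rw [key, le_iff, h2]
    exact hN.posSemidef
  · rw [key, le_iff]
    simpa using hT.pow N 1 .one

theorem PowStable.summable (hT : PosMap T) (h : PowStable T) {X : Matrix ι ι ℝ}
    (hX : X.PosSemidef) : Summable fun k => (T ^ k) X := by
  obtain ⟨R, hR, hc, -⟩ := h.exists_lyapunov hT
  obtain ⟨hcR, q, hq0, hq1, hq⟩ := hT.exists_contraction hR (by norm_num) hc
  obtain ⟨d, hd, hXd⟩ := exists_le_smul_one hX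
  have hle : ∀ k, (T ^ k) X ≤ (2 * d * q ^ k) • R := fun k => by
    have h1 : X ≤ (2 * d) • R := by
      refine hXd.trans ?_
      have := smul_le_smul_of_nonneg_left hcR (show 0 ≤ 2 * d by positivity)
      rwa [smul_smul, show 2 * d * (1 / 2) = d by ring] at this
    calc (T ^ k) X ≤ (T ^ k) ((2 * d) • R) := (hT.pow k).mono h1
      _ = (2 * d) • (T ^ k) R := map_smul _ _ _
      _ ≤ (2 * d) • (q ^ k • R) :=
        smul_le_smul_of_nonneg_left (hT.pow_le_of_le hq0 hq k) (by positivity)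
      _ = _ := by rw [smul_smul]
  refine Pi.summable.2 fun i => Pi.summable.2 fun j => ?_
  refine Summable.of_norm_bounded (g := fun k => 2 * d * q ^ k * R.trace)
    (((summable_geometric_of_lt_one hq0 hq1).mul_left _).mul_right _) fun k => ?_
  have h2 := trace_le_trace_of_le (hle k)
  rw [trace_smul, smul_eq_mul] at h2
  exact (abs_apply_le_trace (hT.pow k X hX) i j).trans h2

/-- A solution of the Lyapunov equation of a stable positive map. -/
theorem PowStable.exists_fixed (hT : PosMap T) (h : PowStable T) {C : Matrix ι ι ℝ}
    (hC : C.PosSemidef) : ∃ X : Matrix ι ι ℝ, X.PosSemidef ∧ X = C + T X ∧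
      Tendsto (fun N => ∑ k ∈ Finset.range N, (T ^ k) C) atTop (𝓝 X) := by
  obtain ⟨X, hX⟩ := h.summable hT hC
  have hlim := hX.tendsto_sum_nat
  refine ⟨X, isClosed_setOf_posSemidef.mem_of_tendsto hlim
    (.of_forall fun N => posSemidef_sum _ fun k _ => hT.pow k C hC), ?_, hlim⟩
  have h1 := (tendsto_add_atTop_iff_nat 1).2 hlim
  refine tendsto_nhds_unique h1 ?_
  have h2 : ∀ N, ∑ k ∈ Finset.range (N + 1), (T ^ k) C
      = C + T (∑ k ∈ Finset.range N, (T ^ k) C) := fun N => by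
    rw [Finset.sum_range_succ', map_sum, add_comm]
    congr 1
    exact Finset.sum_congr rfl fun k _ => by rw [pow_succ']; rfl
  simp only [h2]
  exact (((continuous_matrixMap T).tendsto X).comp hlim).const_add C

/-- The one-sided Krein–Rutman alternative: a positive map whose powers do not tend to zero has a
positive semidefinite eigenvector with an eigenvalue that is at least one. -/
theorem PosMap.exists_eigenvector (hT : PosMap T) (h : ¬ PowStable T) :
    ∃ (r : ℝ) (Y : Matrix ι ι ℝ), 1 ≤ r ∧ Y.PosSemidef ∧ Y.trace = 1 ∧ T Y = r • Y := by
  -- The parameters `t` in `[0, 1]` for which `t • T` has a normalized Lyapunov matrix. The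
  -- eigenvector arises as a limit of rescaled Lyapunov matrices as `t` tends to the supremum `s`.
  let Φ : ℝ → Prop := fun t => 0 ≤ t ∧ t ≤ 1 ∧ ∃ R : Matrix ι ι ℝ, R.PosSemidef ∧
    (1 / 2 : ℝ) • (1 : Matrix ι ι ℝ) ≤ R - (t • T) R ∧ R - (t • T) R ≤ 1
  have h0 : Φ 0 := ⟨le_rfl, zero_le_one, 1, .one, by
    rw [le_iff]
    have : (1 : Matrix ι ι ℝ) - ((0 : ℝ) • T) 1 - (1 / 2 : ℝ) • (1 : Matrix ι ι ℝ)
        = (1 / 2 : ℝ) • (1 : Matrix ι ι ℝ) := by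
      rw [zero_smul, LinearMap.zero_apply]
      module
    rw [this]
    exact PosSemidef.one.smul (by norm_num), by simp⟩
  have hne : {t | Φ t}.Nonempty := ⟨0, h0⟩
  have hbdd : BddAbove {t | Φ t} := ⟨1, fun t ht => ht.2.1⟩
  obtain ⟨t, -, ht, htΦ⟩ := exists_seq_tendsto_sSup hne hbdd
  set s := sSup {t | Φ t} with hs
  have hs0 : 0 ≤ s := le_csSup hbdd h0
  have hs1 : s ≤ 1 := csSup_le hne fun t ht => ht.2.1
  choose ht0 ht1 R hR hR1 hR2 using htΦ
  have htr : ∀ j, 0 < 1 + (R j).trace := fun j => by linarith [(hR j).trace_nonneg]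
  let a : ℕ → ℝ := fun j => (1 + (R j).trace)⁻¹
  have ha0 : ∀ j, 0 < a j := fun j => inv_pos.2 (htr j)
  have ha1 : ∀ j, a j ≤ 1 := fun j => inv_le_one_of_one_le₀ (by linarith [(hR j).trace_nonneg])
  let Y : ℕ → Matrix ι ι ℝ := fun j => a j • R j
  have hY : ∀ j, (Y j).PosSemidef := fun j => (hR j).smul (ha0 j).le
  have hYtr : ∀ j, (Y j).trace = 1 - a j := fun j => by
    have : a j * (1 + (R j).trace) = 1 := inv_mul_cancel₀ (htr j).ne'
    simp only [Y, trace_smul, smul_eq_mul]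
    linarith
  have : FirstCountableTopology (Matrix ι ι ℝ) :=
    inferInstanceAs (FirstCountableTopology (ι → ι → ℝ))
  let K : Set (Matrix ι ι ℝ × ℝ) :=
    (Set.univ.pi fun _ : ι => Set.univ.pi fun _ : ι => Set.Icc (-1 : ℝ) 1) ×ˢ Set.Icc (0 : ℝ) 1
  have hK : IsCompact K :=
    (isCompact_univ_pi fun _ => isCompact_univ_pi fun _ => isCompact_Icc).prod isCompact_Icc
  have hmem : ∀ j, (Y j, a j) ∈ K := fun j => by
    refine ⟨fun i _ k _ => ?_, (ha0 j).le, ha1 j⟩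
    have h1 := abs_apply_le_trace (hY j) i k
    rw [hYtr] at h1
    exact abs_le.1 (h1.trans (by linarith [ha0 j]))
  obtain ⟨⟨Z, b⟩, hZmem, φ, hφ, hlim⟩ := hK.tendsto_subseq hmem
  have hZlim : Tendsto (fun j => Y (φ j)) atTop (𝓝 Z) :=
    (continuous_fst.tendsto _).comp hlim
  have hblim : Tendsto (fun j => a (φ j)) atTop (𝓝 b) :=
    (continuous_snd.tendsto _).comp hlim
  have htlim : Tendsto (fun j => t (φ j)) atTop (𝓝 s) := ht.comp hφ.tendsto_atTop
  have hZ : Z.PosSemidef := isClosed_setOf_posSemidef.mem_of_tendsto hZlim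
    (.of_forall fun j => hY _)
  have hZtr : Z.trace = 1 - b := by
    refine tendsto_nhds_unique (tendsto_trace hZlim) ?_
    simpa only [Function.comp_def, hYtr] using hblim.const_sub 1
  have hD : Tendsto (fun j => Y (φ j) - t (φ j) • T (Y (φ j))) atTop (𝓝 (Z - s • T Z)) :=
    hZlim.sub (htlim.smul (((continuous_matrixMap T).tendsto Z).comp hZlim))
  have hDeq : ∀ j, Y j - t j • T (Y j) = a j • (R j - (t j • T) (R j)) := fun j => by
    simp only [Y, map_smul, smul_sub, LinearMap.smul_apply]
    rw [smul_comm]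
  have hlo : (b * (1 / 2)) • (1 : Matrix ι ι ℝ) ≤ Z - s • T Z := by
    refine le_of_tendsto_matrix ((hblim.mul_const _).smul_const _) hD (.of_forall fun j => ?_)
    rw [hDeq, mul_smul]
    exact smul_le_smul_of_nonneg_left (hR1 _) (ha0 _).le
  have hhi : Z - s • T Z ≤ b • (1 : Matrix ι ι ℝ) := by
    refine le_of_tendsto_matrix hD (hblim.smul_const _) (.of_forall fun j => ?_)
    rw [hDeq]
    exact smul_le_smul_of_nonneg_left (hR2 _) (ha0 _).le
  have hb0 : 0 ≤ b := hZmem.2.1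
  -- If `b = 0`, the Lyapunov matrices blow up along the subsequence, and the limit is an exact
  -- solution of `Z = s • T Z` of trace one. If `b > 0`, then `Z` is a Lyapunov matrix at `s`
  -- itself: `s = 1` contradicts instability, and `s < 1` contradicts the supremum.
  rcases hb0.eq_or_lt with hb | hb
  · subst hb
    rw [zero_smul] at hhi
    rw [zero_mul, zero_smul] at hlo
    have he : Z = s • T Z := sub_eq_zero.1 (le_antisymm hhi hlo)
    have hspos : s ≠ 0 := by
      intro h0
      rw [h0, zero_smul] at he
      rw [he, trace_zero] at hZtr
      norm_num at hZtr
    refine ⟨s⁻¹, Z, (one_le_inv₀ (hs0.lt_of_ne' hspos)).2 hs1, hZ, by simpa using hZtr, ?_⟩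
    nth_rw 2 [he]
    rw [smul_smul, inv_mul_cancel₀ hspos, one_smul]
  · exfalso
    have hZ' : (b / 2) • (1 : Matrix ι ι ℝ) ≤ Z - s • T Z := by
      rwa [mul_one_div] at hlo
    rcases hs1.eq_or_lt with h1 | h1
    · refine h (PowStable.of_lyapunov hT hZ (half_pos hb) ?_)
      rwa [h1, one_smul] at hZ'
    · obtain ⟨d, hd, hTd⟩ := exists_le_smul_one (hT Z hZ)
      -- Small enough that `s + δ ≤ 1` and that `δ • T Z` uses up at most half of the margin `b /
      -- 2`.
      let δ := min (1 - s) (b / 4 / d)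
      have hδ : 0 < δ := lt_min (by linarith) (by positivity)
      have hδd : δ * d ≤ b / 4 := by
        calc δ * d ≤ b / 4 / d * d := by gcongr; exact min_le_right _ _
          _ = _ := div_mul_cancel₀ _ hd.ne'
      have hlt : (b / 4) • (1 : Matrix ι ι ℝ) ≤ Z - ((s + δ) • T) Z := by
        have e : Z - ((s + δ) • T) Z = (Z - s • T Z) - δ • T Z := by
          rw [LinearMap.smul_apply, add_smul]; abel
        have h3 : δ • T Z ≤ (b / 4) • (1 : Matrix ι ι ℝ) := by
          refine (smul_le_smul_of_nonneg_left hTd hδ.le).trans ?_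
          rw [smul_smul]
          exact smul_le_smul_of_nonneg_right hδd (nonneg_iff_posSemidef.2 .one)
        rw [e]
        have h4 : (b / 4) • (1 : Matrix ι ι ℝ)
            = (b / 2) • (1 : Matrix ι ι ℝ) - (b / 4) • (1 : Matrix ι ι ℝ) := by
          rw [← sub_smul]; congr 1; ring
        rw [h4]
        exact sub_le_sub hZ' h3
      have hpos : PosMap ((s + δ) • T) := hT.smul (by linarith)
      have hst := PowStable.of_lyapunov hpos hZ (by linarith) hlt
      have hmem' : Φ (s + δ) :=
        ⟨by linarith, by linarith [min_le_left (1 - s) (b / 4 / d)], hst.exists_lyapunov hpos⟩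
      have := le_csSup hbdd hmem'
      linarith

/-- Stability passes to a map that is adjoint for the trace pairing. -/
theorem PowStable.adjoint {T' : Matrix ι ι ℝ →ₗ[ℝ] Matrix ι ι ℝ}
    (hT' : PosMap T') (hadj : ∀ X Y, (T' X * Y).trace = (X * T Y).trace) (h : PowStable T) :
    PowStable T' := by
  have hk : ∀ k X Y, ((T' ^ k) X * Y).trace = (X * (T ^ k) Y).trace := fun k => by
    induction k with
    | zero => simp
    | succ k ih =>
      intro X Y
      rw [pow_succ', pow_succ]
      change (T' ((T' ^ k) X) * Y).trace = (X * (T ^ k) (T Y)).trace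
      rw [hadj, ih]
  have htr : ∀ k, ((T' ^ k) 1).trace = ((T ^ k) 1).trace := fun k => by
    simpa using hk k 1 1
  refine tendsto_zero_of_trace (fun k => hT'.pow k 1 .one) ?_
  simpa only [htr, trace_zero] using tendsto_trace h

end PositiveOperators

end StochLQR

namespace StochLQR

open scoped MatrixOrder
open Matrix

/-! ### Moment operators, completing the square and the Riccati equation -/

section ClosedLoop

variable {n m : ℕ}

/-- The evolution `X ↦ A X Aᵀ + σ A₁ X A₁ᵀ` of the second moments of
`x (k+1) = A x k + (A₁ x k) v k`. -/
def lyapMap (A A₁ : Matrix (Fin n) (Fin n) ℝ) (σ : ℝ) :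
    Matrix (Fin n) (Fin n) ℝ →ₗ[ℝ] Matrix (Fin n) (Fin n) ℝ where
  toFun X := A * X * Aᵀ + σ • (A₁ * X * A₁ᵀ)
  map_add' X Y := by simp only [mul_add, add_mul, smul_add]; abel
  map_smul' c X := by
    simp only [mul_smul_comm, smul_mul_assoc, RingHom.id_apply, smul_add, smul_comm c σ]

theorem lyapMap_apply (A A₁ : Matrix (Fin n) (Fin n) ℝ) (σ : ℝ) (X : Matrix (Fin n) (Fin n) ℝ) :
    lyapMap A A₁ σ X = A * X * Aᵀ + σ • (A₁ * X * A₁ᵀ) := rfl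

theorem posMap_lyapMap (A A₁ : Matrix (Fin n) (Fin n) ℝ) {σ : ℝ} (hσ : 0 ≤ σ) :
    PosMap (lyapMap A A₁ σ) :=
  fun _ hX => (hX.conj_transpose A).add ((hX.conj_transpose A₁).smul hσ)

theorem trace_lyapMap_transpose_mul (A A₁ : Matrix (Fin n) (Fin n) ℝ) (σ : ℝ)
    (X Y : Matrix (Fin n) (Fin n) ℝ) :
    (lyapMap Aᵀ A₁ᵀ σ X * Y).trace = (X * lyapMap A A₁ σ Y).trace := by
  have h : ∀ C : Matrix (Fin n) (Fin n) ℝ, (Cᵀ * X * C * Y).trace = (X * (C * Y * Cᵀ)).trace :=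
    fun C => by
      rw [Matrix.mul_assoc Cᵀ, Matrix.mul_assoc Cᵀ, trace_mul_comm]
      simp only [Matrix.mul_assoc]
  simp only [lyapMap_apply, transpose_transpose, add_mul, mul_add, trace_add, smul_mul_assoc,
    mul_smul_comm, trace_smul, h]

/-- The matrix `[I; L]ᵀ F [I; L]`. -/
def restrict (F : Matrix (Fin n ⊕ Fin m) (Fin n ⊕ Fin m) ℝ) (L : Matrix (Fin m) (Fin n) ℝ) :
    Matrix (Fin n) (Fin n) ℝ :=
  (fromRows (1 : Matrix (Fin n) (Fin n) ℝ) L)ᵀ * F *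
    fromRows (1 : Matrix (Fin n) (Fin n) ℝ) L

theorem restrict_fromBlocks (F₁₁ : Matrix (Fin n) (Fin n) ℝ) (F₁₂ : Matrix (Fin n) (Fin m) ℝ)
    (F₂₁ : Matrix (Fin m) (Fin n) ℝ) (F₂₂ : Matrix (Fin m) (Fin m) ℝ)
    (L : Matrix (Fin m) (Fin n) ℝ) :
    restrict (fromBlocks F₁₁ F₁₂ F₂₁ F₂₂) L = F₁₁ + F₁₂ * L + Lᵀ * F₂₁ + Lᵀ * F₂₂ * L := by
  rw [restrict, transpose_fromRows, Matrix.mul_assoc, fromBlocks_mul_fromRows,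
    fromCols_mul_fromRows]
  simp only [transpose_one, Matrix.one_mul, Matrix.mul_one, Matrix.mul_add, Matrix.mul_assoc]
  abel

theorem restrict_mono {F G : Matrix (Fin n ⊕ Fin m) (Fin n ⊕ Fin m) ℝ} (h : F ≤ G)
    (L : Matrix (Fin m) (Fin n) ℝ) : restrict F L ≤ restrict G L := by
  have := PosSemidef.transpose_conj (M := G - F) h (fromRows (1 : Matrix (Fin n) (Fin n) ℝ) L)
  rw [le_iff]
  simpa only [restrict, Matrix.mul_sub, Matrix.sub_mul] using this

theorem isSymm_toBlocks₂₂ {F : Matrix (Fin n ⊕ Fin m) (Fin n ⊕ Fin m) ℝ} (hF : F.IsSymm) :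
    F.toBlocks₂₂.IsSymm := by
  ext i j
  exact hF.apply (Sum.inr i) (Sum.inr j)

theorem isSymm_toBlocks₁₁ {F : Matrix (Fin n ⊕ Fin m) (Fin n ⊕ Fin m) ℝ} (hF : F.IsSymm) :
    F.toBlocks₁₁.IsSymm := by
  ext i j
  exact hF.apply (Sum.inl i) (Sum.inl j)

theorem toBlocks₂₁_eq_transpose {F : Matrix (Fin n ⊕ Fin m) (Fin n ⊕ Fin m) ℝ} (hF : F.IsSymm) :
    F.toBlocks₂₁ = F.toBlocks₁₂ᵀ := by
  ext i j
  exact hF.apply (Sum.inl j) (Sum.inr i)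

theorem isSymm_inv {M : Matrix (Fin m) (Fin m) ℝ} (h : M.IsSymm) : M⁻¹.IsSymm := by
  rw [IsSymm, transpose_nonsing_inv, h]

theorem isSymm_schur {F : Matrix (Fin n ⊕ Fin m) (Fin n ⊕ Fin m) ℝ} (hF : F.IsSymm) :
    (schur F).IsSymm := by
  refine (isSymm_toBlocks₁₁ hF).sub ?_
  simp only [IsSymm, transpose_mul, transpose_transpose,
    (isSymm_inv (isSymm_toBlocks₂₂ hF)).eq, Matrix.mul_assoc]

/-- Completing the square. -/
theorem restrict_eq_schur_add {F : Matrix (Fin n ⊕ Fin m) (Fin n ⊕ Fin m) ℝ} (hF : F.IsSymm)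
    (hu : IsUnit F.toBlocks₂₂) (L : Matrix (Fin m) (Fin n) ℝ) :
    restrict F L = schur F + (L - gain F)ᵀ * F.toBlocks₂₂ * (L - gain F) := by
  have hdet : IsUnit F.toBlocks₂₂.det := (isUnit_iff_isUnit_det _).1 hu
  have h1 : F.toBlocks₂₂ * (L - gain F) = F.toBlocks₂₂ * L + F.toBlocks₁₂ᵀ := by
    rw [gain, sub_neg_eq_add, Matrix.mul_add, mul_nonsing_inv_cancel_left _ _ hdet]
  have h2 : (L - gain F)ᵀ = Lᵀ + F.toBlocks₁₂ * F.toBlocks₂₂⁻¹ := by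
    rw [gain, sub_neg_eq_add, transpose_add, transpose_mul, transpose_transpose,
      (isSymm_inv (isSymm_toBlocks₂₂ hF)).eq]
  have h3 : F.toBlocks₁₂ * F.toBlocks₂₂⁻¹ * (F.toBlocks₂₂ * L) = F.toBlocks₁₂ * L := by
    rw [Matrix.mul_assoc, nonsing_inv_mul_cancel_left _ _ hdet]
  conv_lhs => rw [← fromBlocks_toBlocks F, toBlocks₂₁_eq_transpose hF]
  rw [restrict_fromBlocks, Matrix.mul_assoc (L - gain F)ᵀ, h1, h2, schur, Matrix.add_mul,
    Matrix.mul_add, Matrix.mul_add, h3]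
  simp only [Matrix.mul_assoc]
  abel

theorem schur_le_restrict {F : Matrix (Fin n ⊕ Fin m) (Fin n ⊕ Fin m) ℝ} (hF : F.IsSymm)
    (h : F.toBlocks₂₂.PosDef) (L : Matrix (Fin m) (Fin n) ℝ) : schur F ≤ restrict F L := by
  rw [restrict_eq_schur_add hF h.isUnit, le_iff, add_sub_cancel_left]
  exact h.posSemidef.transpose_conj _

theorem eq_of_conj_eq_zero {M : Matrix (Fin m) (Fin m) ℝ} (hM : M.PosDef)
    {L L' : Matrix (Fin m) (Fin n) ℝ} (h : (L - L')ᵀ * M * (L - L') = 0) : L = L' := by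
  have h1 : (M * ((L - L') * (L - L')ᵀ)).trace ≤ 0 := by
    rw [← Matrix.mul_assoc, trace_mul_comm, ← Matrix.mul_assoc, h, trace_zero]
  have h2 : ((L - L') * (L - L')ᵀ).PosSemidef := by
    simpa using (PosSemidef.one (n := Fin n) (R := ℝ)).conj_transpose (L - L')
  have h3 := eq_zero_of_trace_mul_le_zero hM h2 h1
  have h4 : (L - L') * (L - L')ᴴ = 0 := by
    rwa [conjTranspose_eq_transpose_of_trivial]
  exact sub_eq_zero.1 (self_mul_conjTranspose_eq_zero.1 h4)

namespace Data

variable (S : Data n m)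

/-- The second moment evolution of the closed loop with gain `L`. -/
def closedLoop (L : Matrix (Fin m) (Fin n) ℝ) :
    Matrix (Fin n) (Fin n) ℝ →ₗ[ℝ] Matrix (Fin n) (Fin n) ℝ :=
  lyapMap (S.A + S.B * L) (S.A₁ + S.B₁ * L) S.σ

/-- The adjoint of `closedLoop` for the trace pairing. -/
def closedLoopAdj (L : Matrix (Fin m) (Fin n) ℝ) :
    Matrix (Fin n) (Fin n) ℝ →ₗ[ℝ] Matrix (Fin n) (Fin n) ℝ :=
  lyapMap (S.A + S.B * L)ᵀ (S.A₁ + S.B₁ * L)ᵀ S.σ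

/-- The matrix of the running cost under the feedback `L`. -/
def stageCost (L : Matrix (Fin m) (Fin n) ℝ) : Matrix (Fin n) (Fin n) ℝ :=
  S.Q + Lᵀ * S.R * L

theorem posSemidef_stageCost (L : Matrix (Fin m) (Fin n) ℝ) : (S.stageCost L).PosSemidef :=
  S.Q_posSemidef.add (S.R_posDef.posSemidef.transpose_conj L)

theorem trace_closedLoopAdj_mul (L : Matrix (Fin m) (Fin n) ℝ) (X Y : Matrix (Fin n) (Fin n) ℝ) :
    (S.closedLoopAdj L X * Y).trace = (X * S.closedLoop L Y).trace :=
  trace_lyapMap_transpose_mul _ _ _ _ _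

/-- The right-hand side of the dual constraint on `F`, as a function of the Schur complement. -/
def bellman (P : Matrix (Fin n) (Fin n) ℝ) : Matrix (Fin n ⊕ Fin m) (Fin n ⊕ Fin m) ℝ :=
  S.α • ((fromCols S.A S.B)ᵀ * P * fromCols S.A S.B) + S.W
    + (S.α * S.σ) • ((fromCols S.A₁ S.B₁)ᵀ * P * fromCols S.A₁ S.B₁)

theorem lmi_iff (F : Matrix (Fin n ⊕ Fin m) (Fin n ⊕ Fin m) ℝ) (P : Matrix (Fin n) (Fin n) ℝ) :
    (S.α • ((fromCols S.A S.B)ᵀ * P * fromCols S.A S.B) - F + S.W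
      + (S.α * S.σ) • ((fromCols S.A₁ S.B₁)ᵀ * P * fromCols S.A₁ S.B₁)).PosSemidef
      ↔ F ≤ S.bellman P := by
  rw [le_iff, bellman, sub_add_eq_add_sub, sub_add_eq_add_sub]

theorem restrict_bellman (P : Matrix (Fin n) (Fin n) ℝ) (L : Matrix (Fin m) (Fin n) ℝ) :
    restrict (S.bellman P) L = S.stageCost L + S.α • S.closedLoopAdj L P := by
  have h1 : ∀ (A : Matrix (Fin n) (Fin n) ℝ) (B : Matrix (Fin n) (Fin m) ℝ),
      restrict ((fromCols A B)ᵀ * P * fromCols A B) L = (A + B * L)ᵀ * P * (A + B * L) := by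
    intro A B
    have h : fromCols A B * fromRows (1 : Matrix (Fin n) (Fin n) ℝ) L = A + B * L := by
      rw [fromCols_mul_fromRows, Matrix.mul_one]
    rw [← h, transpose_mul, restrict]
    simp only [Matrix.mul_assoc]
  have h2 : restrict S.W L = S.stageCost L := by
    rw [W, restrict_fromBlocks, stageCost]
    simp
  have hadd : ∀ F G : Matrix (Fin n ⊕ Fin m) (Fin n ⊕ Fin m) ℝ,
      restrict (F + G) L = restrict F L + restrict G L := fun F G => by
    simp only [restrict, Matrix.mul_add, Matrix.add_mul]
  have hsmul : ∀ (c : ℝ) (F : Matrix (Fin n ⊕ Fin m) (Fin n ⊕ Fin m) ℝ),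
      restrict (c • F) L = c • restrict F L := fun c F => by
    simp only [restrict, Matrix.mul_smul, Matrix.smul_mul]
  rw [bellman, hadd, hadd, hsmul, hsmul, h1, h1, h2, closedLoopAdj, lyapMap_apply, smul_add,
    smul_smul, transpose_transpose, transpose_transpose]
  abel

/-- The dual constraint reads `F ≤ bellman (schur F)`; by this identity a Riccati solution satisfies
it with equality. -/
theorem H_eq_bellman {P : Matrix (Fin n) (Fin n) ℝ} (hP : P.IsSymm) : S.H P = S.bellman P := by
  have h1 : ∀ (A : Matrix (Fin n) (Fin n) ℝ) (B : Matrix (Fin n) (Fin m) ℝ),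
      (fromCols A B)ᵀ * P * fromCols A B
        = fromBlocks (Aᵀ * P * A) (Aᵀ * P * B) (Aᵀ * P * B)ᵀ (Bᵀ * P * B) := by
    intro A B
    rw [transpose_fromCols, fromRows_mul, fromRows_mul_fromCols]
    simp only [transpose_mul, transpose_transpose, hP.eq, Matrix.mul_assoc]
  rw [H, bellman, h1, h1, W, fromBlocks_smul, fromBlocks_smul, fromBlocks_add, fromBlocks_add,
    H₁₁, H₁₂, H₂₂, add_zero, add_zero, transpose_add, transpose_smul, transpose_smul]
  congr 1
  · abel
  · abel

theorem isSymm_H {P : Matrix (Fin n) (Fin n) ℝ} (hP : P.IsSymm) : (S.H P).IsSymm := by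
  have h : ∀ {k l : ℕ} (M : Matrix (Fin k) (Fin k) ℝ) (C : Matrix (Fin k) (Fin l) ℝ),
      M.IsSymm → (Cᵀ * M * C).IsSymm := fun M C hM => by
    simp only [IsSymm, transpose_mul, transpose_transpose, hM.eq, Matrix.mul_assoc]
  refine IsSymm.fromBlocks ?_ rfl ?_
  · exact (S.Q_posSemidef.isSymm.add ((h _ _ hP).smul _)).add ((h _ _ hP).smul _)
  · exact (S.R_posDef.posSemidef.isSymm.add ((h _ _ hP).smul _)).add ((h _ _ hP).smul _)

variable {S}

theorem posDef_H₂₂ (hσ : 0 ≤ S.σ) {P : Matrix (Fin n) (Fin n) ℝ} (hP : P.PosSemidef) :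
    (S.H₂₂ P).PosDef :=
  (S.R_posDef.add_posSemidef ((hP.transpose_conj _).smul S.α_pos.le)).add_posSemidef
    ((hP.transpose_conj _).smul (mul_nonneg S.α_pos.le hσ))

/-- The factor `α ^ 2` in the Riccati equation comes from the two off-diagonal blocks. The
fixed-point form lets completing the square apply to `H P` and to dual feasible `F` alike. -/
theorem isRiccatiSolution_iff {P : Matrix (Fin n) (Fin n) ℝ} :
    S.IsRiccatiSolution P ↔ P.PosSemidef ∧ P = schur (S.H P) := by
  refine and_congr_right fun hP => ?_
  have h1 : S.H₁₂ P = S.α • (S.Aᵀ * P * S.B + S.σ • (S.A₁ᵀ * P * S.B₁)) := by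
    rw [H₁₂, smul_add, smul_smul]
  have h2 : (S.H₁₂ P)ᵀ = S.α • (S.Bᵀ * P * S.A + S.σ • (S.B₁ᵀ * P * S.A₁)) := by
    rw [h1]
    simp only [transpose_smul, transpose_add, transpose_mul, transpose_transpose,
      hP.isSymm.eq, Matrix.mul_assoc]
  have h3 : schur (S.H P) = S.H₁₁ P - S.H₁₂ P * (S.H₂₂ P)⁻¹ * (S.H₁₂ P)ᵀ := by
    simp only [schur, H, toBlocks_fromBlocks₁₁, toBlocks_fromBlocks₁₂, toBlocks_fromBlocks₂₂]
  rw [h3, h2, h1, H₁₁, H₂₂, Matrix.smul_mul, Matrix.smul_mul, Matrix.mul_smul, smul_smul, ← sq]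

theorem IsRiccatiSolution.dualFeasible (hσ : 0 ≤ S.σ) {P : Matrix (Fin n) (Fin n) ℝ}
    (h : S.IsRiccatiSolution P) : S.DualFeasible (S.H P) P := by
  obtain ⟨hP, he⟩ := isRiccatiSolution_iff.1 h
  refine ⟨S.isSymm_H hP.isSymm, ?_, ?_, ?_⟩
  · simpa [H] using posDef_H₂₂ hσ hP
  · rw [← he, sub_self]
    exact .zero
  · rw [S.lmi_iff, ← he, S.H_eq_bellman hP.isSymm]

theorem restrict_H {P : Matrix (Fin n) (Fin n) ℝ} (hP : P.IsSymm) (L : Matrix (Fin m) (Fin n) ℝ) :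
    restrict (S.H P) L = S.stageCost L + S.α • S.closedLoopAdj L P := by
  rw [S.H_eq_bellman hP, restrict_bellman]

theorem restrict_H_eq (hσ : 0 ≤ S.σ) {P : Matrix (Fin n) (Fin n) ℝ} (hP : P.PosSemidef)
    (L : Matrix (Fin m) (Fin n) ℝ) :
    restrict (S.H P) L
      = schur (S.H P) + (L - gain (S.H P))ᵀ * S.H₂₂ P * (L - gain (S.H P)) := by
  have hu : (S.H P).toBlocks₂₂ = S.H₂₂ P := by simp [H]
  rw [restrict_eq_schur_add (S.isSymm_H hP.isSymm) (by rw [hu]; exact (posDef_H₂₂ hσ hP).isUnit),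
    hu]

theorem DualFeasible.le_bellman {F : Matrix (Fin n ⊕ Fin m) (Fin n ⊕ Fin m) ℝ}
    {M : Matrix (Fin n) (Fin n) ℝ} (h : S.DualFeasible F M) : F ≤ S.bellman (schur F) :=
  (S.lmi_iff _ _).1 h.lmi

end Data

end ClosedLoop

end StochLQR

namespace StochLQR

/-! ### Independence of the state from the current noise -/

section Independence

theorem comap_prod_eq_generateFrom {Ω ξ η : Type*} [MeasurableSpace ξ] [MeasurableSpace η]
    (f : Ω → ξ × η) : MeasurableSpace.comap f inferInstance = MeasurableSpace.generateFrom
      (Set.preimage f '' Set.image2 (· ×ˢ ·) {s | MeasurableSet s} {t | MeasurableSet t}) := by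
  rw [← MeasurableSpace.comap_generateFrom, generateFrom_prod]

variable {Ω : Type*} [MeasurableSpace Ω] {P : Measure Ω}

/-- Exchanging the inner pairings of two independent pairs with independent components. -/
theorem indepFun_prodMk_prodMk_swap [IsProbabilityMeasure P] {α β γ δ : Type*} [MeasurableSpace α] [MeasurableSpace β]
    [MeasurableSpace γ] [MeasurableSpace δ] {a : Ω → α} {b : Ω → β} {c : Ω → γ} {d : Ω → δ}
    (ha : Measurable a) (hb : Measurable b) (hc : Measurable c) (hd : Measurable d)
    (h : IndepFun (fun ω => (a ω, b ω)) (fun ω => (c ω, d ω)) P)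
    (hab : IndepFun a b P) (hcd : IndepFun c d P) :
    IndepFun (fun ω => (a ω, c ω)) (fun ω => (b ω, d ω)) P := by
  rw [IndepFun_iff_Indep]
  -- Rectangles form a generating π-system, and on them the probability of the fourfold intersection
  -- factors completely.
  refine IndepSets.indep (ha.prodMk hc).comap_le (hb.prodMk hd).comap_le
    (isPiSystem_prod.comap _) (isPiSystem_prod.comap _) 
    (comap_prod_eq_generateFrom _) (comap_prod_eq_generateFrom _) ?_
  rw [IndepSets_iff]
  rintro _ _ ⟨_, ⟨s, hs, t, ht, rfl⟩, rfl⟩ ⟨_, ⟨s', hs', t', ht', rfl⟩, rfl⟩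
  have hac := (h.comp measurable_fst measurable_fst).measure_inter_preimage_eq_mul s t hs ht
  have hbd := (h.comp measurable_snd measurable_snd).measure_inter_preimage_eq_mul s' t' hs' ht'
  have h4 := h.measure_inter_preimage_eq_mul (s ×ˢ s') (t ×ˢ t') (hs.prod hs') (ht.prod ht')
  have h1 := hab.measure_inter_preimage_eq_mul s s' hs hs'
  have h2 := hcd.measure_inter_preimage_eq_mul t t' ht ht'
  simp only [Function.comp_def, Set.mk_preimage_prod] at hac hbd h4 ⊢
  rw [show a ⁻¹' s ∩ c ⁻¹' t ∩ (b ⁻¹' s' ∩ d ⁻¹' t')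
      = a ⁻¹' s ∩ b ⁻¹' s' ∩ (c ⁻¹' t ∩ d ⁻¹' t') from Set.inter_inter_inter_comm _ _ _ _,
    h4, h1, h2, hac, hbd]
  ring

variable {n : ℕ} {x0 : Ω → Fin n → ℝ} {w : ℕ → Ω → Fin n → ℝ} {v : ℕ → Ω → ℝ}

theorem measurable_traj (A A₁ : Matrix (Fin n) (Fin n) ℝ) (hx : Measurable x0)
    (hw : ∀ k, Measurable (w k)) (hv : ∀ k, Measurable (v k)) (k : ℕ) :
    Measurable (traj A A₁ x0 w v k) := by
  induction k with
  | zero => exact hx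
  | succ k ih =>
    have h : ∀ C : Matrix (Fin n) (Fin n) ℝ, Measurable fun y : Fin n → ℝ => C *ᵥ y :=
      fun C => Continuous.measurable (by fun_prop)
    exact (((h A).comp ih).add ((hv k).smul ((h A₁).comp ih))).add (hw k)

/-- The state at time `k` is a function of the initial state and the noise before time `k`. -/
theorem traj_eq_comp {Ω : Type*} (A A₁ : Matrix (Fin n) (Fin n) ℝ) (x0 : Ω → Fin n → ℝ)
    (w : ℕ → Ω → Fin n → ℝ) (v : ℕ → Ω → ℝ) (k : ℕ) :
    ∃ g : (Fin n → ℝ) × ((Finset.range k → Fin n → ℝ) × (Finset.range k → ℝ)) → Fin n → ℝ,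
      Measurable g ∧ ∀ ω, traj A A₁ x0 w v k ω = g (x0 ω, fun i => w i ω, fun i => v i ω) := by
  -- The same recursion run on the space of past coordinates serves as `g`. The default noise value
  -- `0` from time `k` on is never read.
  let w' : ℕ → (Fin n → ℝ) × ((Finset.range k → Fin n → ℝ) × (Finset.range k → ℝ)) →
      Fin n → ℝ := fun j z => if h : j ∈ Finset.range k then z.2.1 ⟨j, h⟩ else 0
  let v' : ℕ → (Fin n → ℝ) × ((Finset.range k → Fin n → ℝ) × (Finset.range k → ℝ)) → ℝ :=
    fun j z => if h : j ∈ Finset.range k then z.2.2 ⟨j, h⟩ else 0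
  have hw' : ∀ j, Measurable (w' j) := fun j => by
    by_cases h : j ∈ Finset.range k
    · simp only [w', h, dif_pos]; fun_prop
    · simp only [w', h, dif_neg, not_false_eq_true]; fun_prop
  have hv' : ∀ j, Measurable (v' j) := fun j => by
    by_cases h : j ∈ Finset.range k
    · simp only [v', h, dif_pos]; fun_prop
    · simp only [v', h, dif_neg, not_false_eq_true]; fun_prop
  refine ⟨traj A A₁ Prod.fst w' v' k, measurable_traj A A₁ measurable_fst hw' hv' k, ?_⟩
  have key : ∀ j, j ≤ k → ∀ ω, traj A A₁ x0 w v j ω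
      = traj A A₁ Prod.fst w' v' j (x0 ω, fun i => w i ω, fun i => v i ω) := by
    intro j
    induction j with
    | zero => exact fun _ _ => rfl
    | succ j ih =>
      intro hj ω
      have hmem : j ∈ Finset.range k := Finset.mem_range.2 hj
      simp only [traj, ih (Nat.le_of_succ_le hj) ω, w', v', hmem, dif_pos]
  exact key k le_rfl

/-- Two regroupings: past against present within `w` and `v` becomes joint past against joint
present, and then the initial state is adjoined to the past. Asking only for past–present
independence lets the lemma cover `w = 0` as well. -/
theorem indepFun_traj [IsProbabilityMeasure P] (A A₁ : Matrix (Fin n) (Fin n) ℝ)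
    (hx : Measurable x0) (hw : ∀ k, Measurable (w k)) (hv : ∀ k, Measurable (v k))
    (hxwv : IndepFun x0 (fun ω (k : ℕ) => (w k ω, v k ω)) P)
    (hwv : IndepFun (fun ω (k : ℕ) => w k ω) (fun ω (k : ℕ) => v k ω) P)
    (hww : ∀ k, IndepFun (fun ω (i : Finset.range k) => w i ω) (w k) P)
    (hvv : ∀ k, IndepFun (fun ω (i : Finset.range k) => v i ω) (v k) P) (k : ℕ) :
    IndepFun (traj A A₁ x0 w v k) (fun ω => (w k ω, v k ω)) P := by
  have hpast : ∀ {E : Type} [MeasurableSpace E],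
      Measurable fun f : ℕ → E => ((fun i : Finset.range k => f i), f k) := by
    intro E _
    fun_prop
  have h1 : IndepFun (fun ω => ((fun i : Finset.range k => w i ω), fun i : Finset.range k => v i ω))
      (fun ω => (w k ω, v k ω)) P :=
    indepFun_prodMk_prodMk_swap (by fun_prop) (hw k) (by fun_prop) (hv k)
      (hwv.comp hpast hpast) (hww k) (hvv k)
  -- The trivial second component brings the independence of `x0` into the shape of two pairs.
  have h2 : IndepFun (fun ω => (x0 ω, ()))
      (fun ω => (((fun i : Finset.range k => w i ω), fun i : Finset.range k => v i ω),
        (w k ω, v k ω))) P :=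
    hxwv.comp (φ := fun y => (y, ()))
      (ψ := fun f : ℕ → (Fin n → ℝ) × ℝ =>
        (((fun i : Finset.range k => (f i).1), fun i : Finset.range k => (f i).2), f k))
      (by fun_prop) (by fun_prop)
  have h3 := indepFun_prodMk_prodMk_swap hx measurable_const (by fun_prop)
    ((hw k).prodMk (hv k)) h2 (indepFun_const_right _ _) h1
  obtain ⟨g, hg, hgeq⟩ := traj_eq_comp A A₁ x0 w v k
  rw [show traj A A₁ x0 w v k = g ∘ fun ω => (x0 ω, fun i => w i ω, fun i => v i ω) from
    funext hgeq]
  exact h3.comp hg measurable_snd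

end Independence

/-! ### First and second moments of one step -/

section Moments

open Matrix

variable {Ω : Type*} [MeasurableSpace Ω] {P : Measure Ω} {n : ℕ}

theorem memLp_mulVec {x : Ω → Fin n → ℝ} (hx : MemLp x 2 P) (C : Matrix (Fin n) (Fin n) ℝ) :
    MemLp (fun ω => C *ᵥ x ω) 2 P := by
  refine memLp_pi_iff.2 fun i => ?_
  simp only [mulVec, dotProduct]
  exact memLp_finsetSum _ fun j _ => (hx.eval j).const_mul _

theorem integrable_mul_apply {x : Ω → Fin n → ℝ} (hx : MemLp x 2 P) (i j : Fin n) :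
    Integrable (fun ω => x ω i * x ω j) P :=
  (hx.eval i).integrable_mul (hx.eval j)

theorem integral_mulVec_mul_mulVec {x : Ω → Fin n → ℝ} (hx : MemLp x 2 P)
    (C D : Matrix (Fin n) (Fin n) ℝ) (i j : Fin n) :
    ∫ ω, (C *ᵥ x ω) i * (D *ᵥ x ω) j ∂P = (C * secondMoment P x * Dᵀ) i j := by
  have e : ∀ ω, (C *ᵥ x ω) i * (D *ᵥ x ω) j
      = ∑ l, ∑ k, C i k * D j l * (x ω k * x ω l) := fun ω => by
    simp only [mulVec, dotProduct, Finset.sum_mul_sum]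
    rw [Finset.sum_comm]
    exact Finset.sum_congr rfl fun _ _ => Finset.sum_congr rfl fun _ _ => by ring
  simp only [e]
  rw [integral_finsetSum _ fun l _ => integrable_finsetSum _ fun k _ =>
    (integrable_mul_apply hx k l).const_mul _]
  simp only [mul_apply, transpose_apply, secondMoment, of_apply, Finset.sum_mul]
  refine Finset.sum_congr rfl fun l _ => ?_
  rw [integral_finsetSum _ fun k _ => (integrable_mul_apply hx k l).const_mul _]
  refine Finset.sum_congr rfl fun k _ => ?_
  rw [integral_const_mul]
  ring

theorem integral_dotProduct_mulVec {x : Ω → Fin n → ℝ} (hx : MemLp x 2 P)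
    (C : Matrix (Fin n) (Fin n) ℝ) :
    Integrable (fun ω => x ω ⬝ᵥ C *ᵥ x ω) P ∧
      ∫ ω, x ω ⬝ᵥ C *ᵥ x ω ∂P = (C * secondMoment P x).trace := by
  have hint : ∀ i, Integrable (fun ω => x ω i * (C *ᵥ x ω) i) P := fun i =>
    (hx.eval i).integrable_mul ((memLp_mulVec hx C).eval i)
  refine ⟨by simpa only [dotProduct] using integrable_finsetSum _ fun i _ => hint i, ?_⟩
  simp only [dotProduct]
  rw [integral_finsetSum _ fun i _ => hint i, trace]
  refine Finset.sum_congr rfl fun i _ => ?_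
  have := integral_mulVec_mul_mulVec hx C 1 i i
  simp only [one_mulVec, transpose_one, mul_one] at this
  rw [diag_apply, ← this]
  simp only [mul_comm]

/-- One step of the moment recursion. -/
theorem moment_step [IsProbabilityMeasure P] {A A₁ Sig : Matrix (Fin n) (Fin n) ℝ} {σ : ℝ}
    {x w : Ω → Fin n → ℝ} {v : Ω → ℝ} (hx : MemLp x 2 P) (hw : MemLp w 2 P) (hv : MemLp v 2 P)
    (hind : IndepFun x (fun ω => (w ω, v ω)) P) (hwv : IndepFun w v P)
    (hw0 : meanVec P w = 0) (hwS : secondMoment P w = Sig) (hv0 : ∫ ω, v ω ∂P = 0)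
    (hvσ : ∫ ω, v ω ^ 2 ∂P = σ) :
    MemLp (fun ω => A *ᵥ x ω + v ω • (A₁ *ᵥ x ω) + w ω) 2 P ∧
    meanVec P (fun ω => A *ᵥ x ω + v ω • (A₁ *ᵥ x ω) + w ω) = A *ᵥ meanVec P x ∧
    secondMoment P (fun ω => A *ᵥ x ω + v ω • (A₁ *ᵥ x ω) + w ω)
      = lyapMap A A₁ σ (secondMoment P x) + Sig := by
  have hp := memLp_mulVec hx A
  have hq := memLp_mulVec hx A₁
  have hmul : ∀ (C : Matrix (Fin n) (Fin n) ℝ), Continuous fun y : Fin n → ℝ => C *ᵥ y :=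
    fun C => by fun_prop
  have hfac : ∀ (f : (Fin n → ℝ) → ℝ) (g : (Fin n → ℝ) × ℝ → ℝ), Measurable f → Measurable g →
      Integrable (fun ω => f (x ω)) P → Integrable (fun ω => g (w ω, v ω)) P →
      Integrable (fun ω => f (x ω) * g (w ω, v ω)) P ∧
        ∫ ω, f (x ω) * g (w ω, v ω) ∂P = (∫ ω, f (x ω) ∂P) * ∫ ω, g (w ω, v ω) ∂P := by
    intro f g hf hg hfi hgi
    have hi : IndepFun (fun ω => f (x ω)) (fun ω => g (w ω, v ω)) P := hind.comp hf hg
    exact ⟨hi.integrable_mul hfi hgi,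
      hi.integral_fun_mul_eq_mul_integral hfi.aestronglyMeasurable hgi.aestronglyMeasurable⟩
  have hadd : ∀ {f g : Ω → ℝ} {a b : ℝ}, (Integrable f P ∧ ∫ ω, f ω ∂P = a) →
      (Integrable g P ∧ ∫ ω, g ω ∂P = b) →
      (Integrable (fun ω => f ω + g ω) P ∧ ∫ ω, f ω + g ω ∂P = a + b) := by
    rintro f g a b ⟨hf, rfl⟩ ⟨hg, rfl⟩
    exact ⟨hf.add hg, integral_add hf hg⟩
  have hwi : ∀ i, ∫ ω, w ω i ∂P = 0 := fun i => congrFun hw0 i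
  have hwij : ∀ i j, ∫ ω, w ω i * w ω j ∂P = Sig i j := fun i j => by rw [← hwS]; rfl
  have hcomp : ∀ (C : Matrix (Fin n) (Fin n) ℝ) i, Measurable fun y : Fin n → ℝ => (C *ᵥ y) i :=
    fun C i => (measurable_pi_apply i).comp (hmul C).measurable
  have hL1 : ∀ {f : Ω → ℝ}, MemLp f 2 P → Integrable f P := fun h => h.integrable one_le_two
  have hvw : ∀ i, Integrable (fun ω => v ω * w ω i) P ∧ ∫ ω, v ω * w ω i ∂P = 0 := fun i => by
    have hi : IndepFun v (fun ω => w ω i) P :=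
      (hwv.comp (measurable_pi_apply i) measurable_id).symm
    refine ⟨hi.integrable_mul (hL1 hv) (hL1 (hw.eval i)), ?_⟩
    rw [hi.integral_fun_mul_eq_mul_integral hv.1 (hw.eval i).1, hv0, zero_mul]
  -- A product of square integrable variables is square integrable here because the two squares are
  -- independent.
  have hvq : ∀ i, MemLp (fun ω => v ω * (A₁ *ᵥ x ω) i) 2 P := fun i => by
    have hm : AEStronglyMeasurable (fun ω => v ω * (A₁ *ᵥ x ω) i) P := hv.1.mul (hq.eval i).1
    rw [memLp_two_iff_integrable_sq hm]
    have := (hfac (fun y => (A₁ *ᵥ y) i ^ 2) (fun z => z.2 ^ 2) ((hcomp A₁ i).pow_const 2)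
      (by fun_prop) (hq.eval i).integrable_sq hv.integrable_sq).1
    refine this.congr (.of_forall fun ω => ?_)
    simp only [mul_pow, mul_comm]
  have hvq0 : ∀ i, ∫ ω, v ω * (A₁ *ᵥ x ω) i ∂P = 0 := fun i => by
    have := (hfac (fun y => (A₁ *ᵥ y) i) (fun z => z.2) (hcomp A₁ i)
      (by fun_prop) (hL1 (hq.eval i)) (hL1 hv)).2
    rw [hv0, mul_zero] at this
    simpa only [mul_comm] using this
  refine ⟨?_, ?_, ?_⟩
  · refine memLp_pi_iff.2 fun i => ?_
    exact ((hp.eval i).add (hvq i)).add (hw.eval i)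
  · ext i
    simp only [meanVec, Pi.add_apply, Pi.smul_apply, smul_eq_mul]
    have hAx : ∫ ω, (A *ᵥ x ω) i ∂P = (A *ᵥ fun j => ∫ ω, x ω j ∂P) i := by
      simp only [mulVec, dotProduct]
      rw [integral_finsetSum _ fun j _ => (hL1 (hx.eval j)).const_mul _]
      simp only [integral_const_mul]
    have key := hadd (hadd ⟨hL1 (hp.eval i), hAx⟩ ⟨hL1 (hvq i), hvq0 i⟩)
      ⟨hL1 (hw.eval i), hwi i⟩
    rw [key.2, add_zero, add_zero]
    rfl
  · ext i j
    have hxx : ∀ (C D : Matrix (Fin n) (Fin n) ℝ) i j,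
        Integrable (fun ω => (C *ᵥ x ω) i * (D *ᵥ x ω) j) P := fun C D i j =>
      ((memLp_mulVec hx C).eval i).integrable_mul ((memLp_mulVec hx D).eval j)
    have hxv : ∀ (C D : Matrix (Fin n) (Fin n) ℝ) i j,
        Integrable (fun ω => (C *ᵥ x ω) i * (D *ᵥ x ω) j * v ω) P ∧
          ∫ ω, (C *ᵥ x ω) i * (D *ᵥ x ω) j * v ω ∂P = 0 := fun C D i j => by
      have := hfac (fun y => (C *ᵥ y) i * (D *ᵥ y) j) (fun z => z.2)
        ((hcomp C i).mul (hcomp D j)) (by fun_prop) (hxx C D i j) (hL1 hv)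
      rwa [hv0, mul_zero] at this
    have hxw : ∀ (C : Matrix (Fin n) (Fin n) ℝ) i j,
        Integrable (fun ω => (C *ᵥ x ω) i * w ω j) P ∧
          ∫ ω, (C *ᵥ x ω) i * w ω j ∂P = 0 := fun C i j => by
      have := hfac (fun y => (C *ᵥ y) i) (fun z => z.1 j) (hcomp C i) (by fun_prop)
        (hL1 ((memLp_mulVec hx C).eval i)) (hL1 (hw.eval j))
      rwa [hwi, mul_zero] at this
    have hxvw : ∀ (C : Matrix (Fin n) (Fin n) ℝ) i j,
        Integrable (fun ω => (C *ᵥ x ω) i * (v ω * w ω j)) P ∧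
          ∫ ω, (C *ᵥ x ω) i * (v ω * w ω j) ∂P = 0 := fun C i j => by
      have := hfac (fun y => (C *ᵥ y) i) (fun z => z.2 * z.1 j) (hcomp C i) (by fun_prop)
        (hL1 ((memLp_mulVec hx C).eval i)) (hvw j).1
      rwa [(hvw j).2, mul_zero] at this
    have hqq : Integrable (fun ω => (A₁ *ᵥ x ω) i * (A₁ *ᵥ x ω) j * v ω ^ 2) P ∧
        ∫ ω, (A₁ *ᵥ x ω) i * (A₁ *ᵥ x ω) j * v ω ^ 2 ∂P
          = (A₁ * secondMoment P x * A₁ᵀ) i j * σ := by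
      have := hfac (fun y => (A₁ *ᵥ y) i * (A₁ *ᵥ y) j) (fun z => z.2 ^ 2)
        ((hcomp A₁ i).mul (hcomp A₁ j)) (by fun_prop) (hxx A₁ A₁ i j) hv.integrable_sq
      rwa [hvσ, integral_mulVec_mul_mulVec hx] at this
    have hpp : Integrable (fun ω => (A *ᵥ x ω) i * (A *ᵥ x ω) j) P ∧
        ∫ ω, (A *ᵥ x ω) i * (A *ᵥ x ω) j ∂P = (A * secondMoment P x * Aᵀ) i j :=
      ⟨hxx A A i j, integral_mulVec_mul_mulVec hx A A i j⟩
    have hww : Integrable (fun ω => w ω i * w ω j) P ∧ ∫ ω, w ω i * w ω j ∂P = Sig i j :=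
      ⟨integrable_mul_apply hw i j, hwij i j⟩
    -- Of the nine products only the three squares survive; each cross term contains a factor with
    -- mean zero.
    have key := hadd (hadd (hadd (hadd (hadd (hadd (hadd (hadd hpp hqq) hww) (hxv A A₁ i j))
      (hxv A₁ A i j)) (hxw A i j)) (hxw A j i)) (hxvw A₁ i j)) (hxvw A₁ j i)
    have hI := key.2
    simp only [secondMoment, of_apply, Pi.add_apply, Pi.smul_apply, smul_eq_mul]
    rw [integral_congr_ae (.of_forall fun ω => ?_), hI]
    · simp only [lyapMap_apply, Matrix.add_apply, Matrix.smul_apply, smul_eq_mul, secondMoment]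
      ring
    · ring

end Moments

end StochLQR

namespace StochLQR

open scoped MatrixOrder
open Matrix

/-! ### Mean square stability and detectability through the moment operator -/

section Stability

variable {Ω : Type u} [MeasurableSpace Ω] {P : Measure Ω} {n : ℕ} {σ : ℝ}
  {A A₁ Sig : Matrix (Fin n) (Fin n) ℝ} {x0 : Ω → Fin n → ℝ} {w : ℕ → Ω → Fin n → ℝ}
  {v : ℕ → Ω → ℝ}

theorem indepFun_past_of_iIndepFun {E : Type*} [MeasurableSpace E] {f : ℕ → Ω → E}
    (hf : iIndepFun f P) (hm : ∀ k, Measurable (f k)) (k : ℕ) :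
    IndepFun (fun ω (i : Finset.range k) => f i ω) (f k) P := by
  have h := hf.indepFun_finset (Finset.range k) {k} (by simp) hm
  exact h.comp measurable_id
    (measurable_pi_apply (⟨k, Finset.mem_singleton_self k⟩ : ({k} : Finset ℕ)))

theorem IsMultiplicativeNoise.integral_sq [IsProbabilityMeasure P]
    (h : IsMultiplicativeNoise P v σ) (k : ℕ) : ∫ ω, v k ω ^ 2 ∂P = σ := by
  rw [← h.variance_eq k, variance_of_integral_eq_zero (h.measurable k).aemeasurable
    (h.mean_zero k)]

theorem secondMoment_eq_cov_add [IsProbabilityMeasure P] {x : Ω → Fin n → ℝ}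
    (hx : MemLp x 2 P) :
    secondMoment P x = covMatrix P x + vecMulVec (meanVec P x) (meanVec P x) := by
  ext i j
  have := covariance_eq_sub (hx.eval i) (hx.eval j)
  simp only [secondMoment, covMatrix, Matrix.add_apply, of_apply, vecMulVec_apply, meanVec, this,
    Pi.mul_apply]
  ring

theorem posSemidef_secondMoment {x : Ω → Fin n → ℝ} (hx : MemLp x 2 P) :
    (secondMoment P x).PosSemidef := by
  refine posSemidef_iff_isSymm_dotProduct.2 ⟨?_, fun y => ?_⟩
  · ext i j
    simp only [transpose_apply, secondMoment, of_apply, mul_comm]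
  · rw [← trace_mul_vecMulVec_self, trace_mul_comm, ← (integral_dotProduct_mulVec hx _).2]
    refine integral_nonneg fun ω => ?_
    exact (posSemidef_iff_isSymm_dotProduct.1 (posSemidef_vecMulVec_self y)).2 _

theorem NoiseAssumption.posDef_secondMoment [IsProbabilityMeasure P]
    (h : NoiseAssumption P x0 w v Sig σ) : (secondMoment P x0).PosDef := by
  rw [secondMoment_eq_cov_add h.init_memLp]
  exact h.init_cov_posDef.add_posSemidef (posSemidef_vecMulVec_self _)

theorem NoiseAssumption.moments [IsProbabilityMeasure P] (h : NoiseAssumption P x0 w v Sig σ)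
    (A A₁ : Matrix (Fin n) (Fin n) ℝ) (k : ℕ) :
    MemLp (traj A A₁ x0 w v k) 2 P ∧
    meanVec P (traj A A₁ x0 w v (k + 1)) = A *ᵥ meanVec P (traj A A₁ x0 w v k) ∧
    secondMoment P (traj A A₁ x0 w v (k + 1))
      = lyapMap A A₁ σ (secondMoment P (traj A A₁ x0 w v k)) + Sig := by
  have hw := h.additive
  have hv := h.multiplicative
  have hind := indepFun_traj A A₁ h.init_measurable hw.measurable hv.measurable h.init_indep
    h.noise_indep (indepFun_past_of_iIndepFun hw.indep hw.measurable)
    (indepFun_past_of_iIndepFun hv.indep hv.measurable)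
  have hstep : ∀ k, MemLp (traj A A₁ x0 w v k) 2 P → _ := fun k hk =>
    moment_step (A := A) (A₁ := A₁) (Sig := Sig) (σ := σ) hk (hw.memLp k) (hv.memLp k) (hind k)
      (h.noise_indep.comp (measurable_pi_apply k) (measurable_pi_apply k)) (hw.mean_zero k)
      (by rw [secondMoment_eq_cov_add (hw.memLp k), hw.mean_zero k, hw.cov_eq k]; simp)
      (hv.mean_zero k) (hv.integral_sq k)
  have hmem : ∀ k, MemLp (traj A A₁ x0 w v k) 2 P := fun k => by
    induction k with
    | zero => exact h.init_memLp
    | succ k ih => exact (hstep k ih).1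
  exact ⟨hmem k, (hstep k (hmem k)).2⟩

theorem IsMultiplicativeNoise.moments [IsProbabilityMeasure P] (hv : IsMultiplicativeNoise P v σ)
    (A A₁ : Matrix (Fin n) (Fin n) ℝ) (ξ : Fin n → ℝ) (k : ℕ) :
    MemLp (traj A A₁ (fun _ => ξ) 0 v k) 2 P ∧
    secondMoment P (traj A A₁ (fun _ => ξ) 0 v k) = (lyapMap A A₁ σ ^ k) (vecMulVec ξ ξ) := by
  have hind := indepFun_traj (P := P) (w := (0 : ℕ → Ω → Fin n → ℝ)) A A₁
    (measurable_const (a := ξ)) (fun _ => measurable_const) hv.measurable (indepFun_const_left _ _)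
    (indepFun_const_left (0 : ℕ → Fin n → ℝ) _) (fun k => indepFun_const_right _ _)
    (indepFun_past_of_iIndepFun hv.indep hv.measurable)
  have hstep : ∀ k, MemLp (traj A A₁ (fun _ => ξ) 0 v k) 2 P → _ := fun k hk =>
    moment_step (A := A) (A₁ := A₁) (Sig := 0) (σ := σ) hk (memLp_const 0) (hv.memLp k) (hind k)
      (indepFun_const_left _ _) (by ext; simp [meanVec]) (by ext; simp [secondMoment])
      (hv.mean_zero k) (hv.integral_sq k)
  have hmem : ∀ k, MemLp (traj A A₁ (fun _ => ξ) 0 v k) 2 P := fun k => by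
    induction k with
    | zero => exact memLp_const ξ
    | succ k ih => exact (hstep k ih).1
  refine ⟨hmem k, ?_⟩
  induction k with
  | zero => ext; simp [secondMoment, traj, vecMulVec_apply]
  | succ k ih =>
    have := (hstep k (hmem k)).2.2
    rw [add_zero, ih] at this
    rw [pow_succ']
    exact this

theorem NoiseAssumption.secondMoment_traj [IsProbabilityMeasure P]
    (h : NoiseAssumption P x0 w v Sig σ) (A A₁ : Matrix (Fin n) (Fin n) ℝ) (k : ℕ) :
    secondMoment P (traj A A₁ x0 w v k) = (lyapMap A A₁ σ ^ k) (secondMoment P x0)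
      + ∑ j ∈ Finset.range k, (lyapMap A A₁ σ ^ j) Sig := by
  induction k with
  | zero => simp [traj]
  | succ k ih =>
    rw [(h.moments A A₁ k).2.2, ih, map_add, map_sum, pow_succ', Finset.sum_range_succ', add_assoc]
    simp only [pow_succ', Module.End.mul_apply, pow_zero, Module.End.one_apply]

/-- The outer square of the mean evolves by `A · Aᵀ` alone, which the full moment operator
dominates. Hence decay of the operator powers forces the means to zero. -/
theorem NoiseAssumption.vecMulVec_meanVec_traj_le [IsProbabilityMeasure P]
    (h : NoiseAssumption P x0 w v Sig σ) (A A₁ : Matrix (Fin n) (Fin n) ℝ) (k : ℕ) :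
    vecMulVec (meanVec P (traj A A₁ x0 w v k)) (meanVec P (traj A A₁ x0 w v k))
      ≤ (lyapMap A A₁ σ ^ k) (vecMulVec (meanVec P x0) (meanVec P x0)) := by
  have hσ := h.multiplicative.variance_pos.le
  induction k with
  | zero => simp [traj]
  | succ k ih =>
    set μ := meanVec P (traj A A₁ x0 w v k)
    rw [(h.moments A A₁ k).2.1, pow_succ']
    refine le_trans ?_ ((posMap_lyapMap A A₁ hσ).mono ih)
    have e : vecMulVec (A *ᵥ μ) (A *ᵥ μ) = A * vecMulVec μ μ * Aᵀ := by
      rw [mul_vecMulVec, vecMulVec_mul, vecMul_transpose]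
    rw [e, lyapMap_apply, le_iff, add_sub_cancel_left]
    exact ((posSemidef_vecMulVec_self μ).conj_transpose A₁).smul hσ

/-- Stability of the second moment evolution implies mean square stability. -/
theorem meanSquareStable_of_powStable (h : PowStable (lyapMap A A₁ σ)) :
    MeanSquareStable.{u} A A₁ Sig σ := by
  intro Ω _ P _ w v
  -- The limit must be named before any initial state, and hence any noise assumption, is available;
  -- `limUnder` is identified only afterwards.
  refine ⟨0, limUnder atTop fun N => ∑ j ∈ Finset.range N, (lyapMap A A₁ σ ^ j) Sig,
    fun x0 hn => ?_⟩
  have hσ := hn.multiplicative.variance_pos.le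
  have hT := posMap_lyapMap A A₁ hσ
  obtain ⟨X, -, -, hX⟩ := h.exists_fixed hT hn.additive.cov_posDef.posSemidef
  rw [hX.limUnder_eq]
  constructor
  · have h1 := tendsto_zero_of_le (fun k => posSemidef_vecMulVec_self _)
      (hn.vecMulVec_meanVec_traj_le A A₁) (h.tendsto hT (posSemidef_vecMulVec_self _))
    refine tendsto_pi_nhds.2 fun i => ?_
    have h2 := (tendsto_pi_nhds.1 (tendsto_pi_nhds.1 h1 i) i).sqrt
    simp only [vecMulVec_apply, Real.sqrt_mul_self_eq_abs, Matrix.zero_apply, Real.sqrt_zero] at h2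
    exact (tendsto_zero_iff_abs_tendsto_zero _).2 h2
  · simp only [hn.secondMoment_traj]
    simpa using (h.tendsto hT hn.posDef_secondMoment.posSemidef).add hX

/-- Supplies a second initial state for the same noise, so that independence of the limit from the
initial state can be exploited. -/
theorem NoiseAssumption.two_smul [IsProbabilityMeasure P] (h : NoiseAssumption P x0 w v Sig σ) :
    NoiseAssumption P (fun ω => (2 : ℝ) • x0 ω) w v Sig σ where
  init_measurable := h.init_measurable.const_smul (2 : ℝ)
  init_memLp := h.init_memLp.const_smul (2 : ℝ)
  init_cov_posDef := by
    have : covMatrix P (fun ω => (2 : ℝ) • x0 ω) = (4 : ℝ) • covMatrix P x0 := by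
      ext i j
      simp only [covMatrix, of_apply, Matrix.smul_apply, Pi.smul_apply, smul_eq_mul]
      rw [covariance_const_mul_left, covariance_const_mul_right]
      ring
    rw [this]
    exact h.init_cov_posDef.smul (by norm_num)
  init_indep := h.init_indep.comp (φ := fun y => (2 : ℝ) • y) (measurable_const_smul _)
    measurable_id
  additive := h.additive
  multiplicative := h.multiplicative
  noise_indep := h.noise_indep

/-- On a noise model that satisfies the standing assumptions, mean square stability forces
stability of the second moment evolution. -/
theorem MeanSquareStable.powStable [IsProbabilityMeasure P] (h : MeanSquareStable.{u} A A₁ Sig σ)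
    (hn : NoiseAssumption P x0 w v Sig σ) : PowStable (lyapMap A A₁ σ) := by
  obtain ⟨_, X, hX⟩ := h Ω P w v
  have h1 := (hX _ hn).2
  have h2 := (hX _ hn.two_smul).2
  have h3 : secondMoment P (fun ω => (2 : ℝ) • x0 ω) = (4 : ℝ) • secondMoment P x0 := by
    ext i j
    simp only [secondMoment, of_apply, Matrix.smul_apply, Pi.smul_apply, smul_eq_mul]
    rw [← integral_const_mul]
    congr 1
    ext ω
    ring
  refine PowStable.of_posDef (posMap_lyapMap A A₁ hn.multiplicative.variance_pos.le)
    hn.posDef_secondMoment ?_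
  -- The contributions of the additive noise cancel, leaving `T ^ k` applied to `4 X₀ - X₀ = 3 X₀`.
  have h4 := (h2.sub h1).const_smul (3 : ℝ)⁻¹
  rw [sub_self, smul_zero] at h4
  refine h4.congr fun k => ?_
  rw [hn.secondMoment_traj, hn.two_smul.secondMoment_traj, h3, map_smul, add_sub_add_right_eq_sub]
  module

/-- Exact detectability in terms of the second moment evolution. -/
theorem ExactlyDetectable.tendsto_trace [IsProbabilityMeasure P] {Q : Matrix (Fin n) (Fin n) ℝ}
    (h : ExactlyDetectable.{u} A A₁ (psdSqrt Q) σ) (hQ : Q.PosSemidef)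
    (hv : IsMultiplicativeNoise P v σ) {ξ : Fin n → ℝ}
    (h0 : ∀ k, (Q * (lyapMap A A₁ σ ^ k) (vecMulVec ξ ξ)).trace = 0) :
    Tendsto (fun k => ((lyapMap A A₁ σ ^ k) (vecMulVec ξ ξ)).trace) atTop (𝓝 0) := by
  have hsq : psdSqrt Q * psdSqrt Q = Q :=
    CFC.sqrt_mul_sqrt_self Q (nonneg_iff_posSemidef.2 hQ)
  have hsymm : (psdSqrt Q)ᵀ = psdSqrt Q :=
    (nonneg_iff_posSemidef.1 (CFC.sqrt_nonneg Q)).isSymm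
  have hout := h Ω P v hv ξ fun k => by
    obtain ⟨hmem, hmom⟩ := hv.moments A A₁ ξ k
    obtain ⟨hint, he⟩ := integral_dotProduct_mulVec hmem Q
    rw [hmom, h0] at he
    have hnn : ∀ y : Fin n → ℝ, y ⬝ᵥ Q *ᵥ y = psdSqrt Q *ᵥ y ⬝ᵥ psdSqrt Q *ᵥ y := fun y => by
      rw [dotProduct_mulVec (psdSqrt Q *ᵥ y), vecMul_mulVec, hsymm, hsq, dotProduct_comm,
        ← mulVec_transpose, hQ.isSymm]
    have hz := (integral_eq_zero_iff_of_nonneg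
      (fun ω => (posSemidef_iff_isSymm_dotProduct.1 hQ).2 _) hint).1 he
    filter_upwards [hz] with ω hω
    rw [hnn] at hω
    exact dotProduct_self_eq_zero.1 hω
  refine hout.congr fun k => ?_
  obtain ⟨hmem, hmom⟩ := hv.moments A A₁ ξ k
  have := (integral_dotProduct_mulVec hmem 1).2
  rw [one_mul, hmom] at this
  simpa only [one_mulVec] using this

end Stability

end StochLQR

/-! ### Comparison, uniqueness and the dual optimum under detectability -/

namespace StochLQR

open scoped MatrixOrder
open Matrix

theorem PowStable.smul {ι : Type*} [Fintype ι] [DecidableEq ι]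
    {T : Matrix ι ι ℝ →ₗ[ℝ] Matrix ι ι ℝ} (hT : PosMap T) (h : PowStable T) {t : ℝ}
    (ht0 : 0 ≤ t) (ht1 : t ≤ 1) : PowStable (t • T) := by
  obtain ⟨R, hR, hc, -⟩ := h.exists_lyapunov hT
  refine PowStable.of_lyapunov (hT.smul ht0) hR (by norm_num) (hc.trans ?_)
  rw [LinearMap.smul_apply]
  refine sub_le_sub_left ?_ R
  nth_rw 2 [← one_smul ℝ (T R)]
  exact smul_le_smul_of_nonneg_right ht1 (nonneg_iff_posSemidef.2 (hT R hR))

/-- A matrix whose image under a stable adjoint evolution is smaller is positive semidefinite. -/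
theorem PowStable.posSemidef_of_adjoint_le {ι : Type*} [Fintype ι] [DecidableEq ι]
    {T T' : Matrix ι ι ℝ →ₗ[ℝ] Matrix ι ι ℝ} (hT : PosMap T) (h : PowStable T)
    (hadj : ∀ X Y, (T' X * Y).trace = (X * T Y).trace) {D : Matrix ι ι ℝ} (hD : D.IsSymm)
    (hle : T' D ≤ D) : D.PosSemidef := by
  refine posSemidef_of_trace_mul_nonneg hD fun Y hY => ?_
  -- Moving one `T` onto `D` as `T'` can only increase the pairing, while the pairing tends to zero
  -- as `k` grows.
  have hstep : ∀ k, (D * (T ^ k) Y).trace ≤ (D * Y).trace := fun k => by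
    induction k with
    | zero => simp
    | succ k ih =>
      refine le_trans ?_ ih
      have h1 := trace_mul_nonneg (M := D - T' D) hle (hT.pow k Y hY)
      rw [sub_mul, trace_sub, hadj] at h1
      rw [pow_succ', Module.End.mul_apply]
      linarith
  have hlim : Tendsto (fun k => (D * (T ^ k) Y).trace) atTop (𝓝 0) := by
    simpa using tendsto_trace ((h.tendsto hT hY).const_mul D)
  exact le_of_tendsto' hlim hstep

namespace Data

variable {n m : ℕ} {S : Data n m}

theorem posMap_closedLoop (hσ : 0 ≤ S.σ) (L : Matrix (Fin m) (Fin n) ℝ) :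
    PosMap (S.closedLoop L) := posMap_lyapMap _ _ hσ

theorem posMap_closedLoopAdj (hσ : 0 ≤ S.σ) (L : Matrix (Fin m) (Fin n) ℝ) :
    PosMap (S.closedLoopAdj L) := posMap_lyapMap _ _ hσ

theorem trace_smul_closedLoopAdj_mul (L : Matrix (Fin m) (Fin n) ℝ)
    (X Y : Matrix (Fin n) (Fin n) ℝ) :
    ((S.α • S.closedLoopAdj L) X * Y).trace = (X * (S.α • S.closedLoop L) Y).trace := by
  simp only [LinearMap.smul_apply, smul_mul_assoc, mul_smul_comm, trace_smul,
    trace_closedLoopAdj_mul]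

/-- The completed square vanishes at the gain of `H P`, so `P` satisfies the discounted cost
equation of its own gain. -/
theorem IsRiccatiSolution.restrict_eq (hσ : 0 ≤ S.σ) {P : Matrix (Fin n) (Fin n) ℝ}
    (h : S.IsRiccatiSolution P) :
    P = S.stageCost (gain (S.H P)) + (S.α • S.closedLoopAdj (gain (S.H P))) P := by
  obtain ⟨hP, he⟩ := isRiccatiSolution_iff.1 h
  have h1 := restrict_H (S := S) hP.isSymm (gain (S.H P))
  rw [restrict_H_eq hσ hP, ← he, sub_self, Matrix.mul_zero, add_zero] at h1
  exact h1

theorem eq_zero_of_trace_stageCost_mul {L : Matrix (Fin m) (Fin n) ℝ}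
    {Y : Matrix (Fin n) (Fin n) ℝ} (hY : Y.PosSemidef) (h : (S.stageCost L * Y).trace ≤ 0) :
    (S.Q * Y).trace = 0 ∧ L * Y = 0 := by
  have h1 := trace_mul_nonneg S.Q_posSemidef hY
  have h2 : (Lᵀ * S.R * L * Y).trace = (S.R * (L * Y * Lᵀ)).trace := by
    rw [Matrix.mul_assoc Lᵀ, Matrix.mul_assoc Lᵀ, trace_mul_comm]
    simp only [Matrix.mul_assoc]
  have h3 := trace_mul_nonneg S.R_posDef.posSemidef (hY.conj_transpose L)
  rw [stageCost, Matrix.add_mul, trace_add, h2] at h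
  refine ⟨by linarith, ?_⟩
  have h4 := eq_zero_of_trace_mul_le_zero S.R_posDef (hY.conj_transpose L) (by linarith)
  obtain ⟨C, rfl⟩ := exists_eq_transpose_mul_self hY
  have h5 : L * Cᵀ * (L * Cᵀ)ᴴ = 0 := by
    rw [conjTranspose_eq_transpose_of_trivial, transpose_mul, transpose_transpose]
    simpa only [Matrix.mul_assoc] using h4
  rw [← Matrix.mul_assoc, self_mul_conjTranspose_eq_zero.1 h5, Matrix.zero_mul]

theorem closedLoop_apply_of_mul_eq_zero {L : Matrix (Fin m) (Fin n) ℝ}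
    {Y : Matrix (Fin n) (Fin n) ℝ} (hY : Y.IsSymm) (h : L * Y = 0) :
    S.closedLoop L Y = lyapMap S.A S.A₁ S.σ Y := by
  have h' : Y * Lᵀ = 0 := by
    have := congrArg transpose h
    rwa [transpose_mul, hY.eq, transpose_zero] at this
  have h1 : ∀ (A : Matrix (Fin n) (Fin n) ℝ) (B : Matrix (Fin n) (Fin m) ℝ),
      (A + B * L) * Y * (A + B * L)ᵀ = A * Y * Aᵀ := fun A B => by
    have h2 : A * Y * (Lᵀ * Bᵀ) = 0 := by
      rw [Matrix.mul_assoc, ← Matrix.mul_assoc Y, h', Matrix.zero_mul, Matrix.mul_zero]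
    rw [Matrix.add_mul, Matrix.mul_assoc B, h, Matrix.mul_zero, add_zero, transpose_add,
      transpose_mul, Matrix.mul_add, h2, add_zero]
  rw [closedLoop, lyapMap_apply, lyapMap_apply, h1, h1]

/-- Under exact detectability, a gain with a finite cost matrix stabilizes the discounted
closed loop. -/
theorem powStable_of_exactlyDetectable {Ω : Type u} [MeasurableSpace Ω] {μ : Measure Ω}
    [IsProbabilityMeasure μ] {v : ℕ → Ω → ℝ} (hv : IsMultiplicativeNoise μ v S.σ)
    (hdet : ExactlyDetectable.{u} S.A S.A₁ (psdSqrt S.Q) S.σ) {L : Matrix (Fin m) (Fin n) ℝ}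
    {P : Matrix (Fin n) (Fin n) ℝ} (hP : P.PosSemidef)
    (he : P = S.stageCost L + (S.α • S.closedLoopAdj L) P) :
    PowStable (S.α • S.closedLoop L) := by
  have hσ := hv.variance_pos.le
  by_contra hns
  obtain ⟨r, Y, hr, hY, hYtr, hYe⟩ :=
    ((posMap_closedLoop hσ L).smul S.α_pos.le).exists_eigenvector hns
  -- With `r ≥ 1` and `tr (P Y) ≥ 0`, the running cost on `Y` is at most zero. Hence `L Y = 0`, and
  -- `Y` is also an eigenvector of the uncontrolled, undiscounted evolution, with eigenvalue `r /
  -- α`.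
  have h1 : (P * Y).trace = (S.stageCost L * Y).trace + r * (P * Y).trace := by
    conv_lhs => rw [he]
    rw [Matrix.add_mul, trace_add, trace_smul_closedLoopAdj_mul, hYe, Matrix.mul_smul, trace_smul,
      smul_eq_mul]
  have h2 := trace_mul_nonneg hP hY
  obtain ⟨hQY, hLY⟩ := eq_zero_of_trace_stageCost_mul (S := S) (L := L) hY (by nlinarith)
  set T := lyapMap S.A S.A₁ S.σ with hTdef
  have hT : PosMap T := posMap_lyapMap _ _ hσ
  have hTY : T Y = (r / S.α) • Y := by
    have h3 : S.α • T Y = r • Y := by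
      rw [← hYe, LinearMap.smul_apply, closedLoop_apply_of_mul_eq_zero hY.isSymm hLY]
    rw [div_eq_inv_mul, mul_smul, ← h3, smul_smul, inv_mul_cancel₀ S.α_pos.ne', one_smul]
  have hTk : ∀ k, (T ^ k) Y = (r / S.α) ^ k • Y := fun k => by
    induction k with
    | zero => simp
    | succ k ih =>
      rw [pow_succ', Module.End.mul_apply, ih, map_smul, hTY, smul_smul, pow_succ]
  -- Detectability concerns deterministic initial states, so `Y` is split into rank-one terms. Each
  -- is dominated by `Y` and therefore also produces zero output.
  obtain ⟨C, hC⟩ := exists_eq_transpose_mul_self hY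
  have hsum : Y = ∑ i, vecMulVec (C i) (C i) := by
    rw [hC]
    ext a b
    simp [mul_apply, Matrix.sum_apply, vecMulVec_apply]
  have hle : ∀ i, vecMulVec (C i) (C i) ≤ Y := fun i => by
    rw [hsum]
    exact Finset.single_le_sum (f := fun i => vecMulVec (C i) (C i))
      (fun j _ => nonneg_iff_posSemidef.2 (posSemidef_vecMulVec_self (C j))) (Finset.mem_univ i)
  have hlim : ∀ i, Tendsto (fun k => ((T ^ k) (vecMulVec (C i) (C i))).trace) atTop (𝓝 0) := by
    refine fun i => hdet.tendsto_trace S.Q_posSemidef hv fun k => le_antisymm ?_ ?_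
    · have h3 := trace_mul_nonneg (N := (T ^ k) Y - (T ^ k) (vecMulVec (C i) (C i)))
        S.Q_posSemidef ((hT.pow k).mono (hle i))
      rw [Matrix.mul_sub, trace_sub, hTk, Matrix.mul_smul, trace_smul, hQY, smul_zero] at h3
      linarith
    · exact trace_mul_nonneg S.Q_posSemidef (hT.pow k _ (posSemidef_vecMulVec_self _))
  have hlim' : Tendsto (fun k => ((T ^ k) Y).trace) atTop (𝓝 0) := by
    have := tendsto_finsetSum Finset.univ fun i _ => hlim i
    rw [Finset.sum_const_zero] at this
    refine this.congr fun k => ?_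
    rw [hsum, map_sum, trace_sum]
  have hone : ∀ k, 1 ≤ ((T ^ k) Y).trace := fun k => by
    rw [hTk, trace_smul, hYtr, smul_eq_mul, mul_one]
    exact one_le_pow₀ ((one_le_div S.α_pos).2 (S.α_lt_one.le.trans hr))
  have := ge_of_tendsto' hlim' hone
  norm_num at this

/-- The Schur complement of every feasible point of the dual problem is bounded by the cost matrix
of every gain that stabilizes the discounted closed loop. -/
theorem DualFeasible.schur_le (hσ : 0 ≤ S.σ) {F : Matrix (Fin n ⊕ Fin m) (Fin n ⊕ Fin m) ℝ}
    {M : Matrix (Fin n) (Fin n) ℝ} (hF : S.DualFeasible F M) {L : Matrix (Fin m) (Fin n) ℝ}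
    {P : Matrix (Fin n) (Fin n) ℝ} (hP : P.PosSemidef)
    (he : P = S.stageCost L + (S.α • S.closedLoopAdj L) P)
    (hst : PowStable (S.α • S.closedLoop L)) : schur F ≤ P := by
  have h1 : schur F ≤ S.stageCost L + (S.α • S.closedLoopAdj L) (schur F) := by
    have := (schur_le_restrict hF.symm hF.posDef L).trans (restrict_mono hF.le_bellman L)
    rwa [restrict_bellman] at this
  refine hst.posSemidef_of_adjoint_le ((posMap_closedLoop hσ L).smul S.α_pos.le)
    (trace_smul_closedLoopAdj_mul L) (hP.isSymm.sub (isSymm_schur hF.symm)) ?_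
  rw [map_sub]
  have h2 : (S.α • S.closedLoopAdj L) P = P - S.stageCost L := by
    rw [eq_sub_iff_add_eq, add_comm]
    exact he.symm
  rw [h2, sub_sub]
  exact sub_le_sub_left h1 P

section Detectable

variable {Ω : Type u} [MeasurableSpace Ω] {μ : Measure Ω} [IsProbabilityMeasure μ]
  {v : ℕ → Ω → ℝ}

theorem DualFeasible.schur_le_riccati (hv : IsMultiplicativeNoise μ v S.σ)
    (hdet : ExactlyDetectable.{u} S.A S.A₁ (psdSqrt S.Q) S.σ)
    {F : Matrix (Fin n ⊕ Fin m) (Fin n ⊕ Fin m) ℝ} {M P : Matrix (Fin n) (Fin n) ℝ}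
    (hF : S.DualFeasible F M) (hP : S.IsRiccatiSolution P) : schur F ≤ P :=
  have he := hP.restrict_eq hv.variance_pos.le
  hF.schur_le hv.variance_pos.le hP.1 he (powStable_of_exactlyDetectable hv hdet hP.1 he)

/-- Each solution is the Schur complement of a dual feasible point, so any two solutions bound each
other. -/
theorem IsRiccatiSolution.unique (hv : IsMultiplicativeNoise μ v S.σ)
    (hdet : ExactlyDetectable.{u} S.A S.A₁ (psdSqrt S.Q) S.σ)
    {P P' : Matrix (Fin n) (Fin n) ℝ} (hP : S.IsRiccatiSolution P)
    (hP' : S.IsRiccatiSolution P') : P = P' := by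
  have hle : ∀ {P P' : Matrix (Fin n) (Fin n) ℝ}, S.IsRiccatiSolution P →
      S.IsRiccatiSolution P' → P ≤ P' := fun {P P'} h h' => by
    have := (h.dualFeasible hv.variance_pos.le).schur_le_riccati hv hdet h'
    rwa [← (isRiccatiSolution_iff.1 h).2] at this
  exact le_antisymm (hle hP hP') (hle hP' hP)

theorem IsRiccatiSolution.dualOptimal (hv : IsMultiplicativeNoise μ v S.σ)
    (hdet : ExactlyDetectable.{u} S.A S.A₁ (psdSqrt S.Q) S.σ)
    {P X₀ : Matrix (Fin n) (Fin n) ℝ} (hP : S.IsRiccatiSolution P)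
    (hX : (X₀ + (S.α / (1 - S.α)) • S.Sig).PosSemidef) : S.DualOptimal X₀ (S.H P) P := by
  refine ⟨hP.dualFeasible hv.variance_pos.le, fun F M hF => ?_⟩
  have hMP : M ≤ P := (le_iff.2 hF.schur_ge).trans (hF.schur_le_riccati hv hdet hP)
  have := trace_mul_nonneg hX (le_iff.1 hMP)
  rw [Matrix.mul_sub, trace_sub] at this
  linarith

/-- All optimal points of the dual problem have the gain of the Riccati solution. -/
theorem DualOptimal.gain_eq (hv : IsMultiplicativeNoise μ v S.σ)
    (hdet : ExactlyDetectable.{u} S.A S.A₁ (psdSqrt S.Q) S.σ)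
    {P X₀ M : Matrix (Fin n) (Fin n) ℝ} {F : Matrix (Fin n ⊕ Fin m) (Fin n ⊕ Fin m) ℝ}
    (hP : S.IsRiccatiSolution P) (hX : (X₀ + (S.α / (1 - S.α)) • S.Sig).PosDef)
    (hF : S.DualOptimal X₀ F M) : gain F = gain (S.H P) := by
  have hσ := hv.variance_pos.le
  have hGP := hF.1.schur_le_riccati hv hdet hP
  have hMG : M ≤ schur F := hF.1.schur_ge
  have hopt := hF.2 _ _ (hP.dualFeasible hσ)
  -- Comparison with the feasible point `(H P, P)` bounds the weighted trace of the positive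
  -- semidefinite gap `P - M` by zero.
  have hMP : P - M = 0 := by
    refine eq_zero_of_trace_mul_le_zero hX (le_iff.1 (hMG.trans hGP)) ?_
    rw [Matrix.mul_sub, trace_sub]
    linarith
  have hG : schur F = P := le_antisymm hGP ((sub_eq_zero.1 hMP).le.trans hMG)
  -- The constraint evaluated at the Riccati gain. The left side is `P` plus a square weighted by
  -- `F₂₂`, so that square vanishes.
  have h1 : restrict F (gain (S.H P)) ≤ P := by
    have := restrict_mono hF.1.le_bellman (gain (S.H P))
    rwa [hG, restrict_bellman, ← LinearMap.smul_apply, ← hP.restrict_eq hσ] at this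
  have h2 := restrict_eq_schur_add hF.1.symm hF.1.posDef.isUnit (gain (S.H P))
  rw [hG] at h2
  refine (eq_of_conj_eq_zero hF.1.posDef (le_antisymm ?_ ?_)).symm
  · rw [h2] at h1
    simpa using h1
  · exact nonneg_iff_posSemidef.2 (hF.1.posDef.posSemidef.transpose_conj _)

end Detectable

end Data

end StochLQR

namespace StochLQR

open scoped MatrixOrder
open Matrix

namespace Data

variable {n m : ℕ} {S : Data n m}

/-! ### Discounted cost, openness of stability and optimal gains -/

section Cost

variable {Ω : Type u} [MeasurableSpace Ω] {μ : Measure Ω} [IsProbabilityMeasure μ]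
  {x0 : Ω → Fin n → ℝ} {w : ℕ → Ω → Fin n → ℝ} {v : ℕ → Ω → ℝ}

theorem admissible_iff_powStable (hn : NoiseAssumption μ x0 w v S.Sig S.σ)
    (L : Matrix (Fin m) (Fin n) ℝ) : Admissible.{u} S L ↔ PowStable (S.closedLoop L) :=
  ⟨fun h => MeanSquareStable.powStable h hn, fun h => meanSquareStable_of_powStable h⟩

/-- The second moment of the closed-loop state. -/
noncomputable def stateMoment (S : Data n m) (μ : Measure Ω) (x0 : Ω → Fin n → ℝ)
    (w : ℕ → Ω → Fin n → ℝ) (v : ℕ → Ω → ℝ) (L : Matrix (Fin m) (Fin n) ℝ) (k : ℕ) :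
    Matrix (Fin n) (Fin n) ℝ :=
  secondMoment μ (traj (S.A + S.B * L) (S.A₁ + S.B₁ * L) x0 w v k)

theorem stateMoment_succ (hn : NoiseAssumption μ x0 w v S.Sig S.σ)
    (L : Matrix (Fin m) (Fin n) ℝ) (k : ℕ) :
    S.stateMoment μ x0 w v L (k + 1) = S.closedLoop L (S.stateMoment μ x0 w v L k) + S.Sig :=
  (hn.moments _ _ k).2.2

theorem posSemidef_stateMoment (hn : NoiseAssumption μ x0 w v S.Sig S.σ)
    (L : Matrix (Fin m) (Fin n) ℝ) (k : ℕ) : (S.stateMoment μ x0 w v L k).PosSemidef :=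
  posSemidef_secondMoment (hn.moments _ _ k).1

theorem cost_eq_tsum (hn : NoiseAssumption μ x0 w v S.Sig S.σ) (L : Matrix (Fin m) (Fin n) ℝ) :
    S.cost μ x0 w v L
      = ∑' k : ℕ, S.α ^ k * (S.stageCost L * S.stateMoment μ x0 w v L k).trace := by
  have h : ∀ x : Fin n → ℝ, Sum.elim x (L *ᵥ x) ⬝ᵥ S.W *ᵥ Sum.elim x (L *ᵥ x)
      = x ⬝ᵥ S.stageCost L *ᵥ x := fun x => by
    rw [W, fromBlocks_mulVec, stageCost, add_mulVec, dotProduct_add]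
    simp only [Sum.elim_comp_inl, Sum.elim_comp_inr, zero_mulVec, add_zero, zero_add,
      Matrix.mul_assoc]
    rw [sumElim_dotProduct_sumElim, ← mulVec_mulVec, ← mulVec_mulVec, dotProduct_mulVec x Lᵀ,
      vecMul_transpose]
  rw [cost]
  refine tsum_congr fun k => ?_
  simp only [h]
  rw [(integral_dotProduct_mulVec (hn.moments _ _ k).1 _).2, stateMoment]

theorem exists_tendsto_stateMoment (hn : NoiseAssumption μ x0 w v S.Sig S.σ)
    {L : Matrix (Fin m) (Fin n) ℝ} (h : PowStable (S.closedLoop L)) :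
    ∃ X, Tendsto (S.stateMoment μ x0 w v L) atTop (𝓝 X) := by
  obtain ⟨_, X, hX⟩ := (admissible_iff_powStable hn L).2 h Ω μ w v
  exact ⟨X, (hX x0 hn).2⟩

theorem exists_tendsto_trace_mul_stateMoment (hn : NoiseAssumption μ x0 w v S.Sig S.σ)
    {L : Matrix (Fin m) (Fin n) ℝ} (h : PowStable (S.closedLoop L))
    (D : Matrix (Fin n) (Fin n) ℝ) :
    ∃ a, Tendsto (fun k => (D * S.stateMoment μ x0 w v L k).trace) atTop (𝓝 a) := by
  obtain ⟨X, hX⟩ := exists_tendsto_stateMoment hn h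
  exact ⟨_, tendsto_trace (hX.const_mul D)⟩

theorem summable_discounted (hn : NoiseAssumption μ x0 w v S.Sig S.σ)
    {L : Matrix (Fin m) (Fin n) ℝ} (h : PowStable (S.closedLoop L))
    (D : Matrix (Fin n) (Fin n) ℝ) :
    Summable fun k => S.α ^ k * (D * S.stateMoment μ x0 w v L k).trace := by
  obtain ⟨a, ha⟩ := exists_tendsto_trace_mul_stateMoment hn h D
  obtain ⟨b, hb⟩ := ha.abs.bddAbove_range
  refine Summable.of_norm_bounded (g := fun k => S.α ^ k * b)
    ((summable_geometric_of_lt_one S.α_pos.le S.α_lt_one).mul_right b) fun k => ?_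
  rw [norm_mul, norm_pow, Real.norm_of_nonneg S.α_pos.le]
  exact mul_le_mul_of_nonneg_left (hb ⟨k, rfl⟩) (pow_nonneg S.α_pos.le k)

/-- The series telescopes. Since `P` need not be the cost matrix of `L`, the costs of two gains can
be compared through one `P`. -/
theorem hasSum_discounted (hn : NoiseAssumption μ x0 w v S.Sig S.σ)
    {L : Matrix (Fin m) (Fin n) ℝ} (h : PowStable (S.closedLoop L))
    (P : Matrix (Fin n) (Fin n) ℝ) :
    HasSum (fun k => S.α ^ k *
        ((P - (S.α • S.closedLoopAdj L) P) * S.stateMoment μ x0 w v L k).trace)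
      (((secondMoment μ x0 + (S.α / (1 - S.α)) • S.Sig) * P).trace) := by
  set X := S.stateMoment μ x0 w v L with hX
  -- The solution of `c = α tr(P Σ) + α c`, which absorbs the additive noise into the telescoping
  -- term.
  set c := S.α / (1 - S.α) * (P * S.Sig).trace with hc
  have hα : 1 - S.α ≠ 0 := (sub_pos.2 S.α_lt_one).ne'
  obtain ⟨a, ha⟩ := exists_tendsto_trace_mul_stateMoment hn h P
  let f : ℕ → ℝ := fun k => S.α ^ k * ((P * X k).trace + c)
  have hf : ∀ k, S.α ^ k * ((P - (S.α • S.closedLoopAdj L) P) * X k).trace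
      = f k - f (k + 1) := fun k => by
    have h1 : S.α * (P * S.Sig).trace + S.α * c = c := by
      rw [hc]; field_simp; ring
    simp only [f]
    rw [Matrix.sub_mul, trace_sub, trace_smul_closedLoopAdj_mul, LinearMap.smul_apply,
      Matrix.mul_smul, trace_smul, smul_eq_mul, hX, stateMoment_succ hn, Matrix.mul_add, trace_add,
      pow_succ]
    linear_combination S.α ^ k * h1
  have hlim : Tendsto f atTop (𝓝 0) := by
    simpa using (tendsto_pow_atTop_nhds_zero_of_lt_one S.α_pos.le S.α_lt_one).mul
      (ha.add_const c)
  have h0 : ((secondMoment μ x0 + (S.α / (1 - S.α)) • S.Sig) * P).trace = f 0 := by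
    simp only [f, pow_zero, one_mul]
    rw [trace_mul_comm, Matrix.mul_add, trace_add, Matrix.mul_smul, trace_smul, smul_eq_mul]
    rfl
  have hsum : Summable fun k => f k - f (k + 1) := (summable_discounted hn h _).congr hf
  rw [funext hf, h0, hsum.hasSum_iff_tendsto_nat]
  simp only [Finset.sum_range_sub']
  simpa using hlim.const_sub (f 0)

/-- Stability is an open condition on the gain. -/
theorem eventually_powStable (hσ : 0 ≤ S.σ) {L : Matrix (Fin m) (Fin n) ℝ}
    (h : PowStable (S.closedLoop L)) : ∀ᶠ L' in 𝓝 L, PowStable (S.closedLoop L') := by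
  -- A Lyapunov matrix for `L` remains one for nearby gains, because the inequality is strict.
  obtain ⟨R, hR, hc, -⟩ := h.exists_lyapunov (posMap_closedLoop hσ L)
  have hcont : Continuous fun L' => R - S.closedLoop L' R := by
    simp only [closedLoop, lyapMap_apply]
    fun_prop
  have hev := eventually_posDef (hcont.tendsto L) (posDef_of_smul_one_le (by norm_num) hc)
    fun L' => hR.isSymm.sub (posMap_closedLoop hσ L' R hR).isSymm
  filter_upwards [hev] with L' hL'
  obtain ⟨c, hc0, hc'⟩ := exists_smul_one_le hL'
  exact PowStable.of_lyapunov (posMap_closedLoop hσ L') hR hc0 hc'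

/-- The cost matrix of an admissible gain. -/
theorem exists_costMatrix (hσ : 0 ≤ S.σ) {L : Matrix (Fin m) (Fin n) ℝ}
    (h : PowStable (S.closedLoop L)) : ∃ P : Matrix (Fin n) (Fin n) ℝ, P.PosSemidef ∧
      P = S.stageCost L + (S.α • S.closedLoopAdj L) P := by
  have hT := (posMap_closedLoop hσ L).smul S.α_pos.le
  have hT' := (posMap_closedLoopAdj hσ L).smul S.α_pos.le
  have h1 := h.smul (posMap_closedLoop hσ L) S.α_pos.le S.α_lt_one.le
  have h2 := h1.adjoint hT' (trace_smul_closedLoopAdj_mul L)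
  obtain ⟨P, hP, he, -⟩ := h2.exists_fixed hT' (S.posSemidef_stageCost L)
  exact ⟨P, hP, he⟩

/-- An optimal gain is the gain of a solution of the Riccati equation. -/
theorem IsOptimalGain.exists_isRiccatiSolution (hn : NoiseAssumption μ x0 w v S.Sig S.σ)
    {L : Matrix (Fin m) (Fin n) ℝ} (hL : S.IsOptimalGain μ x0 w v L) :
    ∃ P, S.IsRiccatiSolution P ∧ L = gain (S.H P) := by
  have hσ := hn.multiplicative.variance_pos.le
  have hst := (admissible_iff_powStable hn L).1 hL.1
  obtain ⟨P, hP, he⟩ := exists_costMatrix hσ hst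
  set K := gain (S.H P) with hK
  set E := (L - K)ᵀ * S.H₂₂ P * (L - K) with hE
  have hEpsd : E.PosSemidef := (posDef_H₂₂ hσ hP).posSemidef.transpose_conj _
  have hPE : P = schur (S.H P) + E := by
    have h1 := restrict_H_eq hσ hP L
    rw [restrict_H hP.isSymm] at h1
    exact he.trans h1
  suffices hE0 : E = 0 by
    rw [hE0, add_zero] at hPE
    exact ⟨P, isRiccatiSolution_iff.2 ⟨hP, hPE⟩, eq_of_conj_eq_zero (posDef_H₂₂ hσ hP) hE0⟩
  -- `K` itself is not known to be admissible, so only a short step from `L` towards it is taken.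
  have hline : Tendsto (fun t : ℝ => L - t • (L - K)) (𝓝[>] 0) (𝓝 L) := by
    have hc : Continuous fun t : ℝ => L - t • (L - K) := by fun_prop
    have := hc.tendsto 0
    rw [zero_smul, sub_zero] at this
    exact this.mono_left nhdsWithin_le_nhds
  obtain ⟨t, hst', ht0, ht1⟩ := ((hline.eventually (eventually_powStable hσ hst)).and
    (Ioo_mem_nhdsGT one_pos)).exists
  set L' := L - t • (L - K) with hL'
  have hs : 0 < 1 - (1 - t) ^ 2 := by nlinarith
  -- The step shrinks `L - K` by `1 - t` and the square `E` by `(1 - t) ^ 2`; `D` is the resulting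
  -- saving per stage.
  set D := (1 - (1 - t) ^ 2) • E with hD
  have hDpsd : D.PosSemidef := hEpsd.smul hs.le
  have hstage : S.stageCost L' = (P - (S.α • S.closedLoopAdj L') P) - D := by
    have h1 := restrict_H_eq hσ hP L'
    have h2 : L' - K = (1 - t) • (L - K) := by rw [hL']; module
    have h3 : (L' - K)ᵀ * S.H₂₂ P * (L' - K) = (1 - t) ^ 2 • E := by
      rw [h2, transpose_smul, Matrix.smul_mul, Matrix.smul_mul, Matrix.mul_smul, smul_smul, sq]
    rw [restrict_H hP.isSymm, ← hK, h3, ← LinearMap.smul_apply] at h1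
    have h4 : S.stageCost L' = schur (S.H P) + (1 - t) ^ 2 • E - (S.α • S.closedLoopAdj L') P :=
      eq_sub_of_add_eq h1
    have h5 : P - (S.α • S.closedLoopAdj L') P - D
        = (schur (S.H P) + E) - (S.α • S.closedLoopAdj L') P - D := by rw [← hPE]
    rw [h4, h5, hD]
    module
  have hcost : S.cost μ x0 w v L
      = ((secondMoment μ x0 + (S.α / (1 - S.α)) • S.Sig) * P).trace := by
    rw [cost_eq_tsum hn, ← (hasSum_discounted hn hst P).tsum_eq]
    rw [sub_eq_of_eq_add he]
  have hcost' : S.cost μ x0 w v L'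
      = ((secondMoment μ x0 + (S.α / (1 - S.α)) • S.Sig) * P).trace
        - ∑' k, S.α ^ k * (D * S.stateMoment μ x0 w v L' k).trace := by
    rw [cost_eq_tsum hn, ← (hasSum_discounted hn hst' P).tsum_eq,
      ← (hasSum_discounted hn hst' P).summable.tsum_sub (summable_discounted hn hst' D)]
    refine tsum_congr fun k => ?_
    rw [hstage, Matrix.sub_mul, trace_sub, mul_sub]
  have hmin := hL.2 L' ((admissible_iff_powStable hn L').2 hst')
  -- The saving at time zero alone suffices, as `X₀` is positive definite and later savings are
  -- nonnegative.
  have hfirst : (D * secondMoment μ x0).trace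
      ≤ ∑' k, S.α ^ k * (D * S.stateMoment μ x0 w v L' k).trace := by
    have := (summable_discounted hn hst' D).le_tsum 0 fun k _ =>
      mul_nonneg (pow_nonneg S.α_pos.le k)
        (trace_mul_nonneg hDpsd (posSemidef_stateMoment hn L' k))
    rwa [pow_zero, one_mul] at this
  have hD0 : D = 0 := by
    refine eq_zero_of_trace_mul_le_zero hn.posDef_secondMoment hDpsd ?_
    rw [trace_mul_comm]
    linarith
  exact (smul_eq_zero.1 hD0).resolve_left hs.ne'

end Cost

end Data

/-! ### Continuity of the gain and Frobenius balls -/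

section Perturbation

variable {n m : ℕ}

theorem continuousAt_gain {F : Matrix (Fin n ⊕ Fin m) (Fin n ⊕ Fin m) ℝ}
    (hF : IsUnit F.toBlocks₂₂) : ContinuousAt gain F := by
  have h12 : Continuous fun G : Matrix (Fin n ⊕ Fin m) (Fin n ⊕ Fin m) ℝ => G.toBlocks₁₂ := by
    simp only [toBlocks₁₂]; fun_prop
  have h22 : Continuous fun G : Matrix (Fin n ⊕ Fin m) (Fin n ⊕ Fin m) ℝ => G.toBlocks₂₂ := by
    simp only [toBlocks₂₂]; fun_prop
  have hdet : F.toBlocks₂₂.det ≠ 0 := ((isUnit_iff_isUnit_det _).1 hF).ne_zero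
  have hinv : ContinuousAt (fun G : Matrix (Fin n ⊕ Fin m) (Fin n ⊕ Fin m) ℝ => G.toBlocks₂₂⁻¹)
      F := by
    simp only [Matrix.inv_def, Ring.inverse_eq_inv']
    exact (h22.matrix_det.continuousAt.inv₀ hdet).smul h22.matrix_adjugate.continuousAt
  have hmul : Continuous fun p : Matrix (Fin m) (Fin m) ℝ × Matrix (Fin m) (Fin n) ℝ =>
      p.1 * p.2 := continuous_fst.matrix_mul continuous_snd
  exact (hmul.continuousAt.comp₂ hinv h12.matrix_transpose.continuousAt).neg

theorem eventually_isUnit_toBlocks₂₂ {F : Matrix (Fin n ⊕ Fin m) (Fin n ⊕ Fin m) ℝ}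
    (hF : IsUnit F.toBlocks₂₂) : ∀ᶠ G in 𝓝 F, IsUnit G.toBlocks₂₂ := by
  have h22 : Continuous fun G : Matrix (Fin n ⊕ Fin m) (Fin n ⊕ Fin m) ℝ => G.toBlocks₂₂ := by
    simp only [toBlocks₂₂]; fun_prop
  have hdet : F.toBlocks₂₂.det ≠ 0 := ((isUnit_iff_isUnit_det _).1 hF).ne_zero
  filter_upwards [h22.matrix_det.continuousAt.eventually_ne hdet] with G hG
  exact (isUnit_iff_isUnit_det _).2 hG.isUnit

end Perturbation

section Frobenius

open scoped Matrix.Norms.Frobenius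

theorem exists_frobNorm_le_of_eventually {ι : Type*} [Fintype ι] {F : Matrix ι ι ℝ}
    {p : Matrix ι ι ℝ → Prop} (h : ∀ᶠ G in 𝓝 F, p G) :
    ∃ ε > 0, ∀ G, frobNorm (G - F) ≤ ε → p G := by
  obtain ⟨ε, hε, h⟩ := Metric.eventually_nhds_iff.1 h
  -- Halving the radius fits a closed ball inside the open one.
  refine ⟨ε / 2, half_pos hε, fun G hG => h ?_⟩
  rw [dist_eq_norm]
  exact lt_of_le_of_lt hG (half_lt_self hε)

end Frobenius

end StochLQR

/-! ### The main theorem -/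

theorem theorem5 {n m : ℕ} (S : StochLQR.Data n m)
    {Ω : Type u} [MeasurableSpace Ω] (P : Measure Ω) [IsProbabilityMeasure P]
    (x0 : Ω → Fin n → ℝ) (w : ℕ → Ω → Fin n → ℝ) (v : ℕ → Ω → ℝ)
    (hnoise : StochLQR.NoiseAssumption P x0 w v S.Sig S.σ)
    (hstab : ∃ L : Matrix (Fin m) (Fin n) ℝ, StochLQR.Data.Admissible.{u} S L)
    (hdet : StochLQR.ExactlyDetectable.{u} S.A S.A₁ (StochLQR.psdSqrt S.Q) S.σ)
    (hopt : ∃ L : Matrix (Fin m) (Fin n) ℝ, S.IsOptimalGain P x0 w v L)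
    (Pstar : Matrix (Fin n) (Fin n) ℝ) (hP : S.IsRiccatiSolution Pstar) :
    S.DualOptimal (StochLQR.secondMoment P x0) (S.H Pstar) Pstar ∧
    ∀ (Fstar : Matrix (Fin n ⊕ Fin m) (Fin n ⊕ Fin m) ℝ) (Mstar : Matrix (Fin n) (Fin n) ℝ),
      S.DualOptimal (StochLQR.secondMoment P x0) Fstar Mstar →
      (∃ ε₀ : ℝ, 0 < ε₀ ∧ ∀ ε : ℝ, 0 < ε → ε ≤ ε₀ →
        ∀ Fhat : Matrix (Fin n ⊕ Fin m) (Fin n ⊕ Fin m) ℝ, Fhat.IsSymm →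
          StochLQR.frobNorm (Fhat - Fstar) ≤ ε →
          IsUnit Fhat.toBlocks₂₂ ∧ StochLQR.Data.Admissible.{u} S (StochLQR.gain Fhat)) ∧
      (∀ (Fhat : ℕ → ℕ → Matrix (Fin n ⊕ Fin m) (Fin n ⊕ Fin m) ℝ) (ε : ℕ → ℕ → ℝ),
        (∀ N K, (Fhat N K).IsSymm) →
        (∀ N K, StochLQR.frobNorm (Fhat N K - Fstar) ≤ ε N K) →
        Tendsto (fun p : ℕ × ℕ => ε p.1 p.2) (atTop ×ˢ atTop) (𝓝 0) →
        ∃ k₀ : ℕ, ∀ N K, k₀ ≤ N → k₀ ≤ K →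
          IsUnit (Fhat N K).toBlocks₂₂ ∧
            StochLQR.Data.Admissible.{u} S (StochLQR.gain (Fhat N K))) := by
  have hv := hnoise.multiplicative
  have hσ := hv.variance_pos.le
  have hX : (StochLQR.secondMoment P x0 + (S.α / (1 - S.α)) • S.Sig).PosDef :=
    hnoise.posDef_secondMoment.add_posSemidef (hnoise.additive.cov_posDef.posSemidef.smul
      (div_nonneg S.α_pos.le (sub_nonneg.2 S.α_lt_one.le)))
  refine ⟨hP.dualOptimal hv hdet hX.posSemidef, fun Fstar Mstar hF => ?_⟩
  obtain ⟨L, hL⟩ := hopt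
  obtain ⟨P', hP', hLP⟩ := hL.exists_isRiccatiSolution hnoise
  -- Uniqueness identifies `Pstar` with the cost matrix `P'` of the optimal gain; this is where
  -- admissibility of the dual gain comes from.
  have hgain : StochLQR.gain Fstar = L := by
    rw [hF.gain_eq hv hdet hP hX, hLP, hP.unique hv hdet hP']
  have hst := (StochLQR.Data.admissible_iff_powStable hnoise L).1 hL.1
  have hunit := hF.1.posDef.isUnit
  have hcont := StochLQR.continuousAt_gain hunit
  have hev : ∀ᶠ G in 𝓝 Fstar, IsUnit G.toBlocks₂₂ ∧
      StochLQR.Data.Admissible.{u} S (StochLQR.gain G) := by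
    have h1 := hcont.eventually (p := fun L' => StochLQR.PowStable (S.closedLoop L'))
      (by rw [hgain]; exact StochLQR.Data.eventually_powStable hσ hst)
    filter_upwards [StochLQR.eventually_isUnit_toBlocks₂₂ hunit, h1] with G hG1 hG2
    exact ⟨hG1, (StochLQR.Data.admissible_iff_powStable hnoise _).2 hG2⟩
  obtain ⟨ε₀, hε₀, hball⟩ := StochLQR.exists_frobNorm_le_of_eventually hev
  refine ⟨⟨ε₀, hε₀, fun ε _ hε G _ hG => hball G (hG.trans hε)⟩, fun G ε _ hG hlim => ?_⟩
  rw [prod_atTop_atTop_eq] at hlim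
  obtain ⟨⟨a, b⟩, hab⟩ := eventually_atTop.1 (hlim.eventually (gt_mem_nhds hε₀))
  refine ⟨max a b, fun N K hN hK => hball _ ((hG N K).trans ?_)⟩
  exact (hab (N, K) ⟨(le_max_left a b).trans hN, (le_max_right a b).trans hK⟩).le
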